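/- **Theorem (Compactness, case $\bar\sigma=\infty$).** Let $\Omega\subset\mathbb R$ be a bounded open interval. Let $\hat f,Q,\omega\in C^0([0,1],[0,\infty))$ vanish exactly at $0$, with $\hat f(1)=1$. Assume that $Q$ and $f(t):=\big(\hat f(t)/Q(1-t)\big)^{1/2}$, $t\in[0,1)$, are non-decreasing in a right neighbourhood of $0$, and that $$\bar\sigma:=\lim_{t\to0^+}\Big(\frac{\omega(t)}{Q(t)}\Big)^{1/2}=\infty .$$ Let $\varphi\in C^0([0,\infty),[0,\infty))$ be non-decreasing with $\varphi^{-1}(\{0\})=\{0\}$, $\varphi(\infty):=\lim_{t\to\infty}\varphi(t)\in(0,\infty)$, and right-differentiable at $0$ with $\varphi'(0^+)\in(0,\infty)$. For $\varepsilon>0$ and $(u,v)\in L^1(\Omega,\mathbb R^2)$ set $$F_\varepsilon(u,v):=\int_\Omega\Big(\varphi(\varepsilon f^2(v))\,|u'|^2+\frac{\omega(1-v)}{4\varepsilon}+\varepsilon|v'|^2\Big)\,dx$$ if $(u,v)\in H^1(\Omega,\mathbb R\times[0,1])$, and $F_\varepsilon(u,v):=\infty$ otherwise, where $\varphi(\varepsilon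 f^2(t))$ is understood as $\varphi(\infty)$ at $t=1$. Let $(u_\varepsilon,v_\varepsilon)_{\varepsilon>0}\subset L^1(\Omega,\mathbb R^2)$ satisfy $$\sup_{\varepsilon>0}\big(F_\varepsilon(u_\varepsilon,v_\varepsilon)+\|u_\varepsilon\|_{L^1(\Omega)}\big)<\infty .$$ Then there are positive numbers $\varepsilon_k\to0$ and a function $u\in L^1(\Omega)\cap GSBV(\Omega)$ with $u'\in L^2(\Omega)$ such that $(u_{\varepsilon_k},v_{\varepsilon_k})\to(u,1)$ $\mathcal L^1$-a.e. on $\Omega$. If, moreover, $(u_\varepsilon)_{\varepsilon>0}$ is equi-integrable, then $u_{\varepsilon_k}\to u$ in $L^1(\Omega)$. Here $u\in L^1(\Omega)$ belongs to $GSBV(\Omega)$ if for every $M\in\mathbb N$ the truncation $u^M:=(u\wedge M)\vee(-M)$ belongs to $SBV(\Omega)$, i.e. its distributional derivative is a finite signed measure on $\Omega$ with zero Cantor part; $u'$ is the (approximate) derivative of $u$, the a.e. unique function with $u'=(u^M)'$ a.e. on $\{|u|\le M\}$ for all $M\in\mathbb N$, where $(u^M)'$ is the density of the absolutely continuous part of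 $Du^M$. -/

import Mathlib

open MeasureTheory Set Filter Topology
open scoped ENNReal ContDiff

namespace PhaseField

/-! ### Sobolev and (generalized) special `BV` functions on a subset `Ω` of the line -/

/-- `φ ∈ C_c^∞(Ω)`. -/
def IsTestFunction (Ω : Set ℝ) (φ : ℝ → ℝ) : Prop :=
  ContDiff ℝ ∞ φ ∧ HasCompactSupport φ ∧ tsupport φ ⊆ Ω

/-- `w` is a weak derivative of `u` on `Ω`. -/
def IsWeakDeriv (Ω : Set ℝ) (u w : ℝ → ℝ) : Prop :=
  ∀ φ : ℝ → ℝ, IsTestFunction Ω φ →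
    ∫ x in Ω, u x * deriv φ x = -∫ x in Ω, w x * φ x

/-- `u ∈ H¹(Ω)`. -/
def MemH1 (Ω : Set ℝ) (u : ℝ → ℝ) : Prop :=
  MemLp u 2 (volume.restrict Ω) ∧
    ∃ w : ℝ → ℝ, MemLp w 2 (volume.restrict Ω) ∧ IsWeakDeriv Ω u w

open Classical in
/-- The weak derivative `u' ∈ L²(Ω)` of `u ∈ H¹(Ω)` (a representative; `0` if `u ∉ H¹(Ω)`). -/
noncomputable def weakDeriv (Ω : Set ℝ) (u : ℝ → ℝ) : ℝ → ℝ :=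
  if h : MemH1 Ω u then h.2.choose else 0

/-- The finite signed Borel measure `μ`, concentrated on `Ω`, is the distributional derivative `Du`
of `u` on `Ω`: `∫_Ω u φ' dx = - ∫_Ω φ dDu` for all `φ ∈ C_c^∞(Ω)`. -/
def IsDistribDeriv (Ω : Set ℝ) (u : ℝ → ℝ) (μ : SignedMeasure ℝ) : Prop :=
  μ.restrict Ω = μ ∧
    ∀ φ : ℝ → ℝ, IsTestFunction Ω φ →
      ∫ x in Ω, u x * deriv φ x = -(∫ᵛ x, φ x ∂•μ)

/-- The set of atoms of a signed measure on the line. When `μ = Du` this is the jump set `J_u`. -/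
def atoms (μ : SignedMeasure ℝ) : Set ℝ := {x | μ {x} ≠ 0}

theorem countable_atoms (μ : SignedMeasure ℝ) : (atoms μ).Countable := by
  have h : Set.Countable {x : ℝ | 0 < μ.totalVariation {x}} :=
    Measure.countable_meas_pos_of_disjoint_iUnion (fun x => measurableSet_singleton x)
      (fun x y hxy => by simpa [Function.onFun] using hxy)
  refine h.mono fun x hx => ?_
  have h1 : (0 : ℝ≥0∞) < ‖μ {x}‖ₑ := by
    rw [enorm_pos]
    exact hx
  exact h1.trans_le (SignedMeasure.enorm_le_totalVariation μ {x})

theorem measurableSet_atoms (μ : SignedMeasure ℝ) : MeasurableSet (atoms μ) :=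
  (countable_atoms μ).measurableSet

/-- The Cantor part: the part of the singular part (with respect to Lebesgue measure) of `μ`
which lives off the atoms of `μ`. -/
noncomputable def cantorPart (μ : SignedMeasure ℝ) : SignedMeasure ℝ :=
  (μ.singularPart volume).restrict (atoms μ)ᶜ

/-- `u ∈ SBV(Ω)`: `u ∈ L¹(Ω)` and `Du` is a finite measure with vanishing Cantor part `D^c u`. -/
def MemSBV (Ω : Set ℝ) (u : ℝ → ℝ) : Prop :=
  MemLp u 1 (volume.restrict Ω) ∧
    ∃ μ : SignedMeasure ℝ, IsDistribDeriv Ω u μ ∧ cantorPart μ = 0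

/-- The truncation `u^M = (u ∧ M) ∨ (-M)`, i.e. `u` cut off at the heights `M` and `-M`. -/
noncomputable def truncate (M : ℕ) (u : ℝ → ℝ) : ℝ → ℝ :=
  fun x => max (min (u x) M) (-M)

/-- `u ∈ GSBV(Ω)` (for `u ∈ L¹(Ω)`): all truncations of `u` belong to `SBV(Ω)`. -/
def MemGSBV (Ω : Set ℝ) (u : ℝ → ℝ) : Prop :=
  ∀ M : ℕ, MemSBV Ω (truncate M u)

/-- `w` is the (approximate) derivative `u'` of the function `u` on `Ω`, all of whose truncations
are of bounded variation: for every `M`, `w = (u^M)'` a.e. on `{|u| ≤ M}`, where `(u^M)'` is the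
density of the absolutely continuous part of `Du^M`. -/
def IsApproxDeriv (Ω : Set ℝ) (u w : ℝ → ℝ) : Prop :=
  ∀ M : ℕ, ∃ μ : SignedMeasure ℝ, IsDistribDeriv Ω (truncate M u) μ ∧
    ∀ᵐ x ∂volume.restrict Ω, |u x| ≤ M → w x = μ.rnDeriv volume x

/-! ### The phase-field energies -/

/-- `f(t) = (f̂(t) / Q(1-t))^{1/2}`, for `t ∈ [0,1)`. -/
noncomputable def fFun (fhat Q : ℝ → ℝ) (t : ℝ) : ℝ := Real.sqrt (fhat t / Q (1 - t))

/-- `φ(ε f²(t))` for `t < 1`, with the value `φ(∞) = φinf` at `t = 1`. -/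
noncomputable def degradation (fhat Q φ : ℝ → ℝ) (φinf ε t : ℝ) : ℝ :=
  if t < 1 then φ (ε * fFun fhat Q t ^ 2) else φinf

open Classical in
/-- The energy `F_ε(u, v)` on `Ω`:
`∫_Ω (φ(ε f²(v)) |u'|² + pot(1-v)/(4ε) + ε |v'|²) dx` if `(u, v) ∈ H¹(Ω, ℝ × [0,1])`,
and `∞` otherwise. -/
noncomputable def energy (Ω : Set ℝ) (fhat Q pot φ : ℝ → ℝ) (φinf ε : ℝ) (u v : ℝ → ℝ) : ℝ≥0∞ :=
  if MemH1 Ω u ∧ MemH1 Ω v ∧ ∀ᵐ x ∂volume.restrict Ω, v x ∈ Icc (0 : ℝ) 1 then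
    ∫⁻ x in Ω, ENNReal.ofReal
      (degradation fhat Q φ φinf ε (v x) * |weakDeriv Ω u x| ^ 2
        + pot (1 - v x) / (4 * ε) + ε * |weakDeriv Ω v x| ^ 2)
  else ⊤

end PhaseField

/-!
In one dimension the energy controls everything through its distribution function. Write `e` for
the energy density of a pair `(u, v)` with continuous representatives `U`, `V`, and
`P x = c⁻¹ ∫_{(a, x)} e` (`energyBelow`), a monotone function bounded independently of `ε`.

* A transition of `V` between two fixed levels below `1` costs a fixed amount `κ` of energy by the
  Modica-Mortola inequality `pot / (4 ε) + ε |V'|² ≥ √pot |V'|`, so an interval carrying less energy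
  than that stays in the region where `v` is near `1` (`le_of_energy_lt`).
* Where `v` is near `1`, the ratio `pot / Q` is as large as we please because `σ̄ = ∞`. Hence either
  `ε f²(v) ≥ 1` and the elastic energy is quadratic in `u'`, or the product of the elastic and the
  damage energy exceeds `n² |u'|²` up to a constant. In both cases `e ≥ c (l |u'| - l² / 4)` for all
  `0 ≤ l ≤ n` (`exists_slope_le_density`). Together this says that intervals of little energy are
  regular (`exists_regularOn`).
* In the limit `ε → 0`, the limit `P₀` of the functions `P` is monotone and bounded, so its
  oscillation is below `κ` off finitely many points. The limit `u` of the functions `U` therefore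
  satisfies `l |u y - u x| ≤ l² (y - x) / 4 + P₀ y - P₀ x` for `0 ≤ l ≤ n` on intervals avoiding a
  finite set depending on `n` (`SlopeDominated`, `exists_subseq_slopeDominated`). The same estimate
  makes a subsequence converging at rational points converge a.e.

This inequality contains the structure of `u`. Bounded functions satisfying it are differences of
monotone functions. With `l = n`, it bounds `n |Du|` by `n² / 4` times Lebesgue measure plus the
finite measure `DP₀`, off a finite set; on Lebesgue null sets without atoms this gives
`|Du| ≤ DP₀ / n` for all `n`, so there is no Cantor part (`SlopeDominated.exists_isDistribDeriv`).
Choosing `l = 2 |u'|` at a point of differentiability gives `|u'|² ≤ P₀'`, whose integral is finite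
(`SlopeDominated.memLp_deriv`). Convergence in `L¹` is Vitali's theorem.
-/

namespace PhaseField

/-! ### Continuous representatives of `H¹` functions on an interval -/

/-- The support of a test function on `(a, b)` keeps a positive distance from `a` and `b`. -/
theorem IsTestFunction.exists_subset_Icc {a b : ℝ} (hab : a < b) {ψ : ℝ → ℝ}
    (hψ : IsTestFunction (Ioo a b) ψ) :
    ∃ c d, a < c ∧ c ≤ d ∧ d < b ∧ ∀ x, x ∉ Icc c d → ψ x = 0 := by
  obtain ⟨-, hcomp, hsub⟩ := hψ
  rcases (tsupport ψ).eq_empty_or_nonempty with h | h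
  · refine ⟨(a + b) / 2, (a + b) / 2, by linarith, le_rfl, by linarith, fun x _ => ?_⟩
    exact image_eq_zero_of_notMem_tsupport (by simp [h])
  · obtain ⟨c, hc, hc'⟩ := (show IsCompact (tsupport ψ) from hcomp).exists_isLeast h
    obtain ⟨d, hd, hd'⟩ := (show IsCompact (tsupport ψ) from hcomp).exists_isGreatest h
    refine ⟨c, d, (hsub hc).1, hc' hd, (hsub hd).2, fun x hx => ?_⟩
    exact image_eq_zero_of_notMem_tsupport fun hmem => hx ⟨hc' hmem, hd' hmem⟩

theorem IsTestFunction.eq_zero {Ω : Set ℝ} {ψ : ℝ → ℝ} (hψ : IsTestFunction Ω ψ) {x : ℝ}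
    (hx : x ∉ Ω) : ψ x = 0 :=
  image_eq_zero_of_notMem_tsupport fun h => hx (hψ.2.2 h)

theorem IsTestFunction.continuous {Ω : Set ℝ} {ψ : ℝ → ℝ} (hψ : IsTestFunction Ω ψ) :
    Continuous ψ := hψ.1.continuous

theorem IsTestFunction.hasDerivAt {Ω : Set ℝ} {ψ : ℝ → ℝ} (hψ : IsTestFunction Ω ψ) (x : ℝ) :
    HasDerivAt ψ (deriv ψ x) x :=
  ((hψ.1.differentiable (by simp)) x).hasDerivAt

theorem IsTestFunction.continuous_deriv {Ω : Set ℝ} {ψ : ℝ → ℝ} (hψ : IsTestFunction Ω ψ) :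
    Continuous (deriv ψ) := hψ.1.continuous_deriv (by simp)

theorem IsTestFunction.integrable {Ω : Set ℝ} {ψ : ℝ → ℝ} (hψ : IsTestFunction Ω ψ) :
    Integrable ψ := hψ.continuous.integrable_of_hasCompactSupport hψ.2.1

theorem IsTestFunction.integrable_deriv {Ω : Set ℝ} {ψ : ℝ → ℝ} (hψ : IsTestFunction Ω ψ) :
    Integrable (deriv ψ) :=
  hψ.continuous_deriv.integrable_of_hasCompactSupport hψ.2.1.deriv

theorem IsTestFunction.integrable_mul {Ω : Set ℝ} {ψ : ℝ → ℝ} (hψ : IsTestFunction Ω ψ)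
    {h : ℝ → ℝ} {μ : Measure ℝ} (hh : Integrable h μ) : Integrable (fun x => h x * ψ x) μ := by
  obtain ⟨C, hC⟩ := hψ.2.1.exists_bound_of_continuous hψ.continuous
  exact hh.mul_bdd hψ.continuous.aestronglyMeasurable (Eventually.of_forall hC)

theorem IsTestFunction.integrable_mul_deriv {Ω : Set ℝ} {ψ : ℝ → ℝ} (hψ : IsTestFunction Ω ψ)
    {h : ℝ → ℝ} {μ : Measure ℝ} (hh : Integrable h μ) :
    Integrable (fun x => h x * deriv ψ x) μ := by
  obtain ⟨C, hC⟩ := hψ.2.1.deriv.exists_bound_of_continuous hψ.continuous_deriv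
  exact hh.mul_bdd hψ.continuous_deriv.aestronglyMeasurable (Eventually.of_forall hC)

/-- A test function of vanishing mean is the derivative of a test function. -/
theorem IsTestFunction.exists_primitive {a b : ℝ} (hab : a < b) {ψ : ℝ → ℝ}
    (hψ : IsTestFunction (Ioo a b) ψ) (h0 : ∫ x in Ioo a b, ψ x = 0) :
    ∃ φ, IsTestFunction (Ioo a b) φ ∧ deriv φ = ψ := by
  obtain ⟨c, d, hac, hcd, hdb, hz⟩ := hψ.exists_subset_Icc hab
  have hint : ∀ x y, IntervalIntegrable ψ volume x y := fun x y =>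
    hψ.continuous.intervalIntegrable _ _
  have hd : ∀ x, HasDerivAt (fun x => ∫ t in a..x, ψ t) (ψ x) x := fun x =>
    intervalIntegral.integral_hasDerivAt_right (hint _ _)
      (hψ.continuous.stronglyMeasurableAtFilter _ _) hψ.continuous.continuousAt
  have hderiv : deriv (fun x => ∫ t in a..x, ψ t) = ψ := funext fun x => (hd x).deriv
  have hzero : ∀ x, x ∉ Icc c d → ∫ t in a..x, ψ t = 0 := by
    intro x hx
    rcases lt_or_ge x c with hxc | hxc
    · refine (intervalIntegral.integral_congr (g := fun _ => 0) fun t ht => hz t fun h => ?_).trans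
        (by simp)
      exact absurd (h.1.trans ht.2) (not_le.2 (max_lt hac hxc))
    · have hxd : d < x := not_le.1 fun h => hx ⟨hxc, h⟩
      have h1 : ∫ t in b..x, ψ t = 0 := by
        refine (intervalIntegral.integral_congr (g := fun _ => 0) fun t ht => hz t fun h => ?_).trans
          (by simp)
        exact absurd (ht.1.trans h.2) (not_le.2 (lt_min hdb hxd))
      rw [← intervalIntegral.integral_add_adjacent_intervals (hint a b) (hint b x), h1,
        intervalIntegral.integral_of_le hab.le, integral_Ioc_eq_integral_Ioo, h0, add_zero]
  have hsub : tsupport (fun x => ∫ t in a..x, ψ t) ⊆ Icc c d :=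
    closure_minimal (fun x hx => by_contra fun h => hx (hzero x h)) isClosed_Icc
  refine ⟨_, ⟨?_, ?_, hsub.trans (Icc_subset_Ioo hac hdb)⟩, hderiv⟩
  · rw [contDiff_infty_iff_deriv, hderiv]
    exact ⟨fun x => (hd x).differentiableAt, hψ.1⟩
  · exact HasCompactSupport.of_support_subset_isCompact isCompact_Icc
      ((subset_tsupport _).trans hsub)

theorem exists_isTestFunction_integral_eq_one {a b : ℝ} (hab : a < b) :
    ∃ ψ, IsTestFunction (Ioo a b) ψ ∧ ∫ x in Ioo a b, ψ x = 1 := by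
  let B : ContDiffBump ((a + b) / 2) := ⟨(b - a) / 8, (b - a) / 4, by linarith, by linarith⟩
  have hsub : tsupport (B.normed volume) ⊆ Ioo a b := by
    rw [B.tsupport_normed_eq, Real.closedBall_eq_Icc]
    refine Icc_subset_Ioo ?_ ?_ <;> simp only [B] <;> linarith
  have htest : IsTestFunction (Ioo a b) (B.normed volume) :=
    ⟨B.contDiff_normed, B.hasCompactSupport_normed, hsub⟩
  refine ⟨_, htest, ?_⟩
  rw [setIntegral_eq_integral_of_forall_compl_eq_zero fun x hx => htest.eq_zero hx]
  exact B.integral_normed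

/-- **Du Bois-Reymond's lemma**: an integrable function with vanishing weak derivative on an
interval is constant. -/
theorem ae_eq_const_of_isWeakDeriv_zero {a b : ℝ} (hab : a < b) {h : ℝ → ℝ}
    (hh : IntegrableOn h (Ioo a b)) (hw : IsWeakDeriv (Ioo a b) h 0) :
    ∃ c, ∀ᵐ x ∂volume.restrict (Ioo a b), h x = c := by
  obtain ⟨ψ₀, hψ₀, hψ₀1⟩ := exists_isTestFunction_integral_eq_one hab
  set c := ∫ x in Ioo a b, h x * ψ₀ x with hc
  refine ⟨c, ?_⟩
  have hloc : LocallyIntegrableOn (fun x => h x - c) (Ioo a b) :=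
    (hh.sub (integrableOn_const (by simp))).locallyIntegrableOn
  have key := isOpen_Ioo.ae_eq_zero_of_integral_contDiff_smul_eq_zero hloc ?_
  · rw [ae_restrict_iff' measurableSet_Ioo]
    filter_upwards [key] with x hx hxm using sub_eq_zero.1 (hx hxm)
  intro ψ h1 h2 h3
  have hψ : IsTestFunction (Ioo a b) ψ := ⟨h1, h2, h3⟩
  set m := ∫ x in Ioo a b, ψ x with hm
  have htest : IsTestFunction (Ioo a b) (fun x => ψ x - m * ψ₀ x) := by
    refine ⟨hψ.1.sub (contDiff_const.mul hψ₀.1), hψ.2.1.sub hψ₀.2.1.mul_left, ?_⟩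
    refine (tsupport_sub ψ (fun x => m * ψ₀ x)).trans (union_subset hψ.2.2 ?_)
    exact (closure_mono (Function.support_mul_subset_right (fun _ => m) ψ₀)).trans hψ₀.2.2
  obtain ⟨φ, hφ, hφd⟩ := htest.exists_primitive hab (by
    rw [integral_sub hψ.integrable.integrableOn (hψ₀.integrable.integrableOn.const_mul m),
      integral_const_mul, hψ₀1, mul_one, sub_self])
  have h4 := hw φ hφ
  simp only [hφd, Pi.zero_apply, zero_mul, integral_zero, neg_zero] at h4
  have h5 : ∫ x in Ioo a b, h x * ψ x - m * (h x * ψ₀ x) = 0 := by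
    rw [← h4]; congr 1; ext x; ring
  rw [integral_sub (hψ.integrable_mul hh) ((hψ₀.integrable_mul hh).const_mul m),
    integral_const_mul, ← hc] at h5
  rw [← setIntegral_eq_integral_of_forall_compl_eq_zero (s := Ioo a b) fun x hx => by
    rw [hψ.eq_zero hx, zero_smul]]
  have h6 : ∫ x in Ioo a b, ψ x • (h x - c) = ∫ x in Ioo a b, h x * ψ x - c * ψ x := by
    congr 1; ext x; simp only [smul_eq_mul]; ring
  rw [h6, integral_sub (hψ.integrable_mul hh) (hψ.integrable.integrableOn.const_mul c),
    integral_const_mul]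
  linarith

theorem isWeakDeriv_intervalIntegral {a b : ℝ} (hab : a < b) {w : ℝ → ℝ}
    (hw : IntegrableOn w (Ioo a b)) : IsWeakDeriv (Ioo a b) (fun x => ∫ t in a..x, w t) w := by
  intro φ hφ
  have hwi : IntervalIntegrable w volume a b :=
    (intervalIntegrable_iff_integrableOn_Ioo_of_le hab.le).2 hw
  have hac : AbsolutelyContinuousOnInterval (fun x => ∫ t in a..x, w t) a b :=
    hwi.absolutelyContinuousOnInterval_intervalIntegral (by simp)
  have hac' : AbsolutelyContinuousOnInterval φ a b := by
    apply ContDiffOn.absolutelyContinuousOnInterval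
    exact (hφ.1.of_le (by simp)).contDiffOn
  have h := hac.integral_mul_deriv_eq_deriv_mul hac'
  rw [hφ.eq_zero (x := a) (by simp), hφ.eq_zero (x := b) (by simp), mul_zero, mul_zero, sub_zero,
    zero_sub, intervalIntegral.integral_of_le hab.le, integral_Ioc_eq_integral_Ioo] at h
  rw [h, ← integral_Ioc_eq_integral_Ioo, ← intervalIntegral.integral_of_le hab.le]
  congr 1
  refine intervalIntegral.integral_congr_ae ?_
  filter_upwards [hwi.ae_hasDerivAt_integral] with x hx hxm
  rw [(hx (uIoc_subset_uIcc hxm) a (by simp)).deriv]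

/-- An `H¹` function agrees a.e. with a primitive of its weak derivative. -/
theorem MemH1.exists_representative {a b : ℝ} (hab : a < b) {u : ℝ → ℝ}
    (hu : MemH1 (Ioo a b) u) :
    ∃ U : ℝ → ℝ, ContinuousOn U (Icc a b) ∧ (∀ᵐ x ∂volume.restrict (Ioo a b), u x = U x) ∧
      ∀ x ∈ Icc a b, ∀ y ∈ Icc a b, x ≤ y →
        ENNReal.ofReal |U y - U x| ≤ ∫⁻ t in Ioo x y, ENNReal.ofReal |weakDeriv (Ioo a b) u t| := by
  obtain ⟨hw2, hweak⟩ : MemLp (weakDeriv (Ioo a b) u) 2 (volume.restrict (Ioo a b)) ∧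
      IsWeakDeriv (Ioo a b) u (weakDeriv (Ioo a b) u) := by
    simp only [weakDeriv, dif_pos hu]
    exact hu.2.choose_spec
  set w := weakDeriv (Ioo a b) u
  have hw : IntegrableOn w (Ioo a b) := hw2.integrable (by norm_num)
  have hui : IntegrableOn u (Ioo a b) := hu.1.integrable (by norm_num)
  have hwi : IntervalIntegrable w volume a b :=
    (intervalIntegrable_iff_integrableOn_Ioo_of_le hab.le).2 hw
  have hac : AbsolutelyContinuousOnInterval (fun x => ∫ t in a..x, w t) a b :=
    hwi.absolutelyContinuousOnInterval_intervalIntegral (by simp)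
  have hcont : ContinuousOn (fun x => ∫ t in a..x, w t) (Icc a b) := by
    simpa [uIcc_of_le hab.le] using hac.continuousOn
  have hUi : IntegrableOn (fun x => ∫ t in a..x, w t) (Ioo a b) :=
    (hcont.integrableOn_Icc).mono_set Ioo_subset_Icc_self
  obtain ⟨c, hc⟩ := ae_eq_const_of_isWeakDeriv_zero hab
    (h := fun x => u x - ∫ t in a..x, w t) (hui.sub hUi) (by
      intro φ hφ
      simp only [sub_mul, Pi.zero_apply, zero_mul, integral_zero, neg_zero]
      rw [integral_sub (hφ.integrable_mul_deriv hui) (hφ.integrable_mul_deriv hUi), hweak φ hφ,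
        isWeakDeriv_intervalIntegral hab hw φ hφ, sub_self])
  refine ⟨fun x => c + ∫ t in a..x, w t, continuousOn_const.add hcont, ?_, ?_⟩
  · filter_upwards [hc] with x hx
    linarith
  · intro x hx y hy hxy
    have hsub : ∀ p ∈ Icc a b, ∀ q ∈ Icc a b, IntervalIntegrable w volume p q := fun p hp q hq =>
      hwi.mono_set (by rw [uIcc_of_le hab.le]; exact uIcc_subset_Icc hp hq)
    have ha : a ∈ Icc a b := left_mem_Icc.2 hab.le
    have h1 : c + (∫ t in a..y, w t) - (c + ∫ t in a..x, w t) = ∫ t in Ioo x y, w t := by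
      rw [add_sub_add_left_eq_sub,
        intervalIntegral.integral_interval_sub_left (hsub a ha y hy) (hsub a ha x hx),
        intervalIntegral.integral_of_le hxy, integral_Ioc_eq_integral_Ioo]
    rw [h1, ← Real.norm_eq_abs, ofReal_norm]
    refine (enorm_integral_le_lintegral_enorm _).trans_eq ?_
    simp only [Real.enorm_eq_ofReal_abs]

/-! ### Stieltjes measures of monotone functions and distributional derivatives -/

theorem stieltjes_measure_add {g h k : ℝ → ℝ} (hg : Monotone g) (hh : Monotone h)
    (hk : Monotone k) (e : ∀ x, k x = g x + h x) :
    hk.stieltjesFunction.measure = hg.stieltjesFunction.measure + hh.stieltjesFunction.measure := by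
  have : hk.stieltjesFunction = hg.stieltjesFunction + hh.stieltjesFunction := by
    ext x
    rw [StieltjesFunction.add_apply, hk.stieltjesFunction_eq, hg.stieltjesFunction_eq,
      hh.stieltjesFunction_eq]
    refine rightLim_eq_of_tendsto ?_
    exact ((hg.tendsto_rightLim x).add (hh.tendsto_rightLim x)).congr fun y => (e y).symm
  rw [this, StieltjesFunction.measure_add]

theorem stieltjes_measure_smul {g k : ℝ → ℝ} (c : NNReal) (hg : Monotone g)
    (hk : Monotone k) (e : ∀ x, k x = c * g x) :
    hk.stieltjesFunction.measure = c • hg.stieltjesFunction.measure := by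
  have : hk.stieltjesFunction = c • hg.stieltjesFunction := by
    ext x
    change _ = (c : ℝ) * hg.stieltjesFunction x
    rw [hk.stieltjesFunction_eq, hg.stieltjesFunction_eq]
    refine rightLim_eq_of_tendsto ?_
    exact ((hg.tendsto_rightLim x).const_mul (c : ℝ)).congr fun y => (e y).symm
  rw [this, StieltjesFunction.measure_smul]

/-- A monotone function that is constant near every point of `B` does not charge `B`. -/
theorem stieltjes_measure_eq_zero_of_locally_const {g : ℝ → ℝ} (hg : Monotone g) {B : Set ℝ}
    (hB : ∀ x ∈ B, ∃ c, ∀ᶠ y in 𝓝 x, g y = c) : hg.stieltjesFunction.measure B = 0 := by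
  refine measure_null_of_locally_null B fun x hx => ?_
  obtain ⟨c, hc⟩ := hB x hx
  obtain ⟨p, q, hpq, hsub⟩ := mem_nhds_iff_exists_Ioo_subset.1 hc
  obtain ⟨p', hp1, hp2⟩ := exists_between hpq.1
  obtain ⟨q', hq1, hq2⟩ := exists_between hpq.2
  refine ⟨Ioc p' q', mem_nhdsWithin_of_mem_nhds (Ioc_mem_nhds hp2 hq1), ?_⟩
  have hval : ∀ z ∈ Ioo p q, hg.stieltjesFunction z = c := by
    intro z hz
    rw [hg.stieltjesFunction_eq]
    refine rightLim_eq_of_tendsto ?_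
    refine tendsto_const_nhds.congr' ?_
    filter_upwards [mem_nhdsWithin_of_mem_nhds (Ioo_mem_nhds hz.1 hz.2)] with y hy
    exact (hsub hy).symm
  rw [StieltjesFunction.measure_Ioc, hval q' ⟨by linarith, hq2⟩, hval p' ⟨hp1, by linarith⟩, sub_self,
    ENNReal.ofReal_zero]

theorem stieltjes_measure_null_of_linear {g : ℝ → ℝ} (hg : Monotone g) (c : NNReal)
    (e : ∀ x, g x = c * x) {B : Set ℝ} (hB : volume B = 0) :
    hg.stieltjesFunction.measure B = 0 := by
  rw [stieltjes_measure_smul (g := fun x => x) c monotone_id hg e]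
  have : (monotone_id (α := ℝ)).stieltjesFunction = StieltjesFunction.id := by
    ext x
    rw [Monotone.stieltjesFunction_eq]
    exact continuous_id.continuousWithinAt.rightLim_eq
  change (c • (monotone_id (α := ℝ)).stieltjesFunction.measure) B = 0
  rw [this, ← Real.volume_eq_stieltjes_id, Measure.smul_apply, hB, smul_zero]

/-- Integration by parts of a test function against a monotone function. -/
theorem integral_monotone_mul_deriv {a b : ℝ} (hab : a < b) {g : ℝ → ℝ} (hg : Monotone g)
    {φ : ℝ → ℝ} (hφ : IsTestFunction (Ioo a b) φ) :
    ∫ x in Ioo a b, g x * deriv φ x =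
      -∫ x in Ioo a b, φ x ∂hg.stieltjesFunction.measure := by
  set m := hg.stieltjesFunction.measure.restrict (Ioo a b) with hm
  set G := hg.stieltjesFunction with hG
  set L := Function.leftLim G b with hL
  obtain ⟨C, hC⟩ := hφ.2.1.deriv.exists_bound_of_continuous hφ.continuous_deriv
  have hFT : ∀ x ∈ Icc a b, φ x = ∫ t in Ioo a b, (Iio x).indicator (deriv φ) t := by
    intro x hx
    have h := intervalIntegral.integral_eq_sub_of_hasDerivAt (a := a) (b := x)
      (fun t _ => hφ.hasDerivAt t) (hφ.continuous_deriv.intervalIntegrable _ _)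
    rw [hφ.eq_zero (x := a) (by simp), sub_zero, intervalIntegral.integral_of_le hx.1,
      integral_Ioc_eq_integral_Ioo] at h
    rw [← h, setIntegral_indicator measurableSet_Iio]
    congr 2
    ext t
    simp only [mem_Ioo, mem_inter_iff, mem_Iio]
    exact ⟨fun ht => ⟨⟨ht.1, ht.2.trans_le hx.2⟩, ht.2⟩, fun ht => ⟨ht.1.1, ht.2⟩⟩
  have h0 : ∫ t in Ioo a b, deriv φ t = 0 := by
    rw [← integral_Ioc_eq_integral_Ioo, ← intervalIntegral.integral_of_le hab.le,
      intervalIntegral.integral_eq_sub_of_hasDerivAt (fun t _ => hφ.hasDerivAt t)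
        (hφ.continuous_deriv.intervalIntegrable _ _), hφ.eq_zero (x := a) (by simp),
      hφ.eq_zero (x := b) (by simp), sub_zero]
  have hmeas : Measurable (Function.uncurry fun x t : ℝ => (Iio x).indicator (deriv φ) t) := by
    have : (Function.uncurry fun x t : ℝ => (Iio x).indicator (deriv φ) t) =
        {p : ℝ × ℝ | p.2 < p.1}.indicator (fun p => deriv φ p.2) := by
      ext ⟨x, t⟩
      simp [Function.uncurry, indicator]
    rw [this]
    exact (hφ.continuous_deriv.measurable.comp measurable_snd).indicator
      (measurableSet_lt measurable_snd measurable_fst)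
  have hfin : IsFiniteMeasure m := ⟨by
    rw [hm, Measure.restrict_apply_univ, StieltjesFunction.measure_Ioo]
    exact ENNReal.ofReal_lt_top⟩
  have hint : Integrable (Function.uncurry fun x t : ℝ => (Iio x).indicator (deriv φ) t)
      (m.prod (volume.restrict (Ioo a b))) := by
    refine Integrable.of_bound hmeas.aestronglyMeasurable C (Eventually.of_forall ?_)
    rintro ⟨x, t⟩
    exact (norm_indicator_le_norm_self _ _).trans (hC t)
  have hinner : ∀ t ∈ Ioo a b, ∫ x, (Iio x).indicator (deriv φ) t ∂m = (L - G t) * deriv φ t := by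
    intro t ht
    have h1 : ∀ x, (Iio x).indicator (deriv φ) t = (Ioi t).indicator (fun _ => deriv φ t) x := by
      intro x; simp [indicator]
    simp only [h1]
    rw [integral_indicator_const _ measurableSet_Ioi, smul_eq_mul, hm,
      measureReal_restrict_apply measurableSet_Ioi]
    have h2 : Ioi t ∩ Ioo a b = Ioo t b := by
      ext x; simp only [mem_inter_iff, mem_Ioi, mem_Ioo]
      exact ⟨fun h => ⟨h.1, h.2.2⟩, fun h => ⟨h.1, ht.1.trans h.1, h.2⟩⟩
    rw [h2, measureReal_def, StieltjesFunction.measure_Ioo,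
      ENNReal.toReal_ofReal (sub_nonneg.2 (G.mono.le_leftLim ht.2))]
  have hae : ∀ᵐ x, g x = G x := by
    filter_upwards [hg.countable_not_continuousAt.ae_notMem volume] with x hx
    rw [not_not] at hx
    rw [hG, hg.stieltjesFunction_eq, hx.continuousWithinAt.rightLim_eq]
  have hGi : IntegrableOn G (Ioo a b) :=
    (G.mono.locallyIntegrable.integrableOn_isCompact isCompact_Icc).mono_set Ioo_subset_Icc_self
  have e1 : ∫ x, φ x ∂m = ∫ x, (∫ t in Ioo a b, (Iio x).indicator (deriv φ) t) ∂m := by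
    rw [hm]
    exact setIntegral_congr_fun measurableSet_Ioo fun x hx => hFT x (Ioo_subset_Icc_self hx)
  rw [e1, integral_integral_swap hint, setIntegral_congr_fun measurableSet_Ioo hinner]
  simp only [sub_mul]
  rw [integral_sub (hφ.integrable_deriv.integrableOn.const_mul L) (hφ.integrable_mul_deriv hGi),
    integral_const_mul, h0, mul_zero, zero_sub, neg_neg]
  refine integral_congr_ae ?_
  filter_upwards [ae_restrict_of_ae hae] with x hx
  rw [hx]

theorem integral_lsmul_toSignedMeasure {m : Measure ℝ} [IsFiniteMeasure m] (f : ℝ → ℝ) :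
    ∫ᵛ x, f x ∂•m.toSignedMeasure = ∫ x, f x ∂m := by
  have : (ContinuousLinearMap.lsmul ℝ ℝ : ℝ →L[ℝ] ℝ →L[ℝ] ℝ) =
      (ContinuousLinearMap.lsmul ℝ ℝ).flip := by
    ext
    simp
  rw [this]
  exact VectorMeasure.integral_toSignedMeasure

theorem rnDeriv_toSignedMeasure (m ν : Measure ℝ) [IsFiniteMeasure m] [SigmaFinite ν] :
    m.toSignedMeasure.rnDeriv ν =ᵐ[ν] fun x => (m.rnDeriv ν x).toReal := by
  refine (SignedMeasure.eq_rnDeriv (m.singularPart ν).toSignedMeasure _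
    Measure.integrable_toReal_rnDeriv ?_ ?_).symm
  · obtain ⟨N, hN, h1, h2⟩ := m.mutuallySingular_singularPart ν
    refine VectorMeasure.MutuallySingular.mk N hN (fun t ht htm => ?_) (fun t ht htm => ?_)
    · rw [Measure.toSignedMeasure_apply_measurable htm, measureReal_def, measure_mono_null ht h1,
        ENNReal.toReal_zero]
    · rw [Measure.toENNRealVectorMeasure_apply_measurable htm, measure_mono_null ht h2]
  · rw [withDensityᵥ_toReal (Measure.measurable_rnDeriv m ν).aemeasurable
      (Measure.lintegral_rnDeriv_lt_top m ν).ne]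
    have := isFiniteMeasure_withDensity (Measure.lintegral_rnDeriv_lt_top m ν).ne
    rw [← Measure.toSignedMeasure_add]
    exact Measure.toSignedMeasure_congr (m.singularPart_add_rnDeriv ν).symm

/-- The Cantor part vanishes as soon as the measure does not charge Lebesgue null sets
without atoms. -/
theorem cantorPart_eq_zero {μ : SignedMeasure ℝ}
    (h : ∀ B, MeasurableSet B → volume B = 0 → (∀ x ∈ B, μ {x} = 0) → μ B = 0) :
    cantorPart μ = 0 := by
  obtain ⟨N, hN, h1, h2⟩ := SignedMeasure.mutuallySingular_singularPart μ volume
  ext B hB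
  have hA := (measurableSet_atoms μ).compl
  rw [cantorPart, VectorMeasure.restrict_apply _ hA hB, zero_apply]
  have hD : MeasurableSet ((B ∩ (atoms μ)ᶜ) \ N) := (hB.inter hA).diff hN
  have hD0 : volume ((B ∩ (atoms μ)ᶜ) \ N) = 0 := by
    rw [← Measure.toENNRealVectorMeasure_apply_measurable hD]
    exact h2 _ fun x hx => hx.2
  rw [← VectorMeasure.of_add_of_sdiff (v := μ.singularPart volume) ((hB.inter hA).inter hN)
    (hB.inter hA) inter_subset_left, h1 _ inter_subset_right, zero_add, sdiff_self_inter]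
  have h3 := congrArg (fun ν : SignedMeasure ℝ => ν ((B ∩ (atoms μ)ᶜ) \ N))
    (SignedMeasure.singularPart_add_withDensity_rnDeriv_eq (s := μ) (μ := volume))
  have h4 : volume.withDensityᵥ (μ.rnDeriv volume) ((B ∩ (atoms μ)ᶜ) \ N) = 0 := by
    rw [withDensityᵥ_apply (SignedMeasure.integrable_rnDeriv _ _) hD,
      Measure.restrict_eq_zero.2 hD0, integral_zero_measure]
  have h5 : μ ((B ∩ (atoms μ)ᶜ) \ N) = 0 := h _ hD hD0 fun x hx => not_not.1 hx.1.2
  simp only [add_apply, h4, h5, add_zero] at h3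
  exact h3

/-! ### Functions whose increments are dominated off finite sets -/

/-- For every slope bound `n`, all increments of `u` over intervals avoiding some finite set satisfy
`l |u y - u x| ≤ l² (y - x) / 4 + (P y - P x)` whenever `0 ≤ l ≤ n`. By Young's inequality this says
that the part of `Du` living off finitely many points is, up to an error of mass `O(1 / n)`,
given by an `L²` density controlled by `P`. -/
def SlopeDominated (u P : ℝ → ℝ) : Prop :=
  ∀ n : ℕ, ∃ S : Finset ℝ, ∀ x y, x < y → (∀ s ∈ S, s ∉ Icc x y) →
    ∀ l ∈ Icc (0 : ℝ) n, l * |u y - u x| ≤ l ^ 2 / 4 * (y - x) + (P y - P x)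

/-- A monotone function, constant off `S`, which increases by at least `1` along every
nondegenerate interval `[x, y]` meeting `S`. Points of `S` are counted both by `s < x` and by
`s ≤ x`, so that the endpoints of the interval are seen too. -/
noncomputable def jumpCount (S : Finset ℝ) (x : ℝ) : ℝ :=
  ∑ s ∈ S, ((if s < x then 1 else 0) + (if s ≤ x then 1 else 0))

theorem jumpCount_term_mono (s : ℝ) :
    Monotone fun x : ℝ => ((if s < x then 1 else 0) + (if s ≤ x then 1 else 0) : ℝ) := by
  intro x y hxy
  dsimp only
  split_ifs <;> first | (exfalso; linarith) | norm_num

theorem jumpCount_mono (S : Finset ℝ) : Monotone (jumpCount S) := fun _ _ hxy =>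
  Finset.sum_le_sum fun s _ => jumpCount_term_mono s hxy

theorem one_le_jumpCount_sub {S : Finset ℝ} {x y s : ℝ} (hxy : x < y) (hs : s ∈ S)
    (hsxy : s ∈ Icc x y) : 1 ≤ jumpCount S y - jumpCount S x := by
  rw [jumpCount, jumpCount, ← Finset.sum_sub_distrib]
  refine le_trans ?_ (Finset.single_le_sum
    (fun t _ => sub_nonneg.2 (jumpCount_term_mono t hxy.le)) hs)
  obtain ⟨h1, h2⟩ := hsxy
  dsimp only
  split_ifs <;> first | (exfalso; linarith) | norm_num

theorem jumpCount_locally_const {S : Finset ℝ} {x : ℝ} (hx : x ∉ S) :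
    ∃ c, ∀ᶠ y in 𝓝 x, jumpCount S y = c := by
  refine ⟨jumpCount S x, ?_⟩
  have h : ∀ s ∈ S, ∀ᶠ y in 𝓝 x, (s < y ↔ s < x) ∧ (s ≤ y ↔ s ≤ x) := by
    intro s hs
    rcases lt_or_gt_of_ne (show s ≠ x from fun h => hx (h ▸ hs)) with h | h
    · filter_upwards [lt_mem_nhds h] with y hy
      exact ⟨iff_of_true hy h, iff_of_true hy.le h.le⟩
    · filter_upwards [gt_mem_nhds h] with y hy
      exact ⟨iff_of_false hy.not_gt h.not_gt, iff_of_false hy.not_ge h.not_ge⟩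
  filter_upwards [(Filter.eventually_all_finset S).2 h] with y hy
  refine Finset.sum_congr rfl fun s hs => ?_
  simp only [(hy s hs).1, (hy s hs).2]

/-- The monotone function controlling `n` times the increments of a function bounded by `M`. -/
noncomputable def slopeMajorant (P : ℝ → ℝ) (M : ℝ) (n : ℕ) (S : Finset ℝ) (x : ℝ) : ℝ :=
  (n : ℝ) ^ 2 / 4 * x + P x + 2 * M * n * jumpCount S x

theorem slopeMajorant_mono {P : ℝ → ℝ} (hP : Monotone P) {M : ℝ} (hM : 0 ≤ M) (n : ℕ)
    (S : Finset ℝ) : Monotone (slopeMajorant P M n S) :=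
  ((monotone_id.const_mul (by positivity)).add hP).add
    ((jumpCount_mono S).const_mul (by positivity))

theorem mul_abs_sub_le_slopeMajorant {f P : ℝ → ℝ} (hP : Monotone P) {M : ℝ}
    (hM : ∀ x, |f x| ≤ M) {n : ℕ} {S : Finset ℝ}
    (hS : ∀ x y, x < y → (∀ s ∈ S, s ∉ Icc x y) →
      ∀ l ∈ Icc (0 : ℝ) n, l * |f y - f x| ≤ l ^ 2 / 4 * (y - x) + (P y - P x))
    {x y : ℝ} (hxy : x < y) :
    n * |f y - f x| ≤ slopeMajorant P M n S y - slopeMajorant P M n S x := by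
  have hM0 : 0 ≤ M := (abs_nonneg _).trans (hM x)
  have hn : (0 : ℝ) ≤ n := n.cast_nonneg
  have h1 : (n : ℝ) ^ 2 / 4 * x ≤ (n : ℝ) ^ 2 / 4 * y := by gcongr
  have h2 := hP hxy.le
  unfold slopeMajorant
  by_cases h : ∀ s ∈ S, s ∉ Icc x y
  · have h3 := hS x y hxy h n ⟨hn, le_rfl⟩
    have h4 : 2 * M * n * jumpCount S x ≤ 2 * M * n * jumpCount S y := by
      gcongr; exact jumpCount_mono S hxy.le
    linarith
  · push Not at h
    obtain ⟨s, hs, hsm⟩ := h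
    have h3 := one_le_jumpCount_sub hxy hs hsm
    have h4 : |f y - f x| ≤ 2 * M := (abs_sub _ _).trans (by linarith [hM x, hM y])
    have h5 : 2 * M * n * 1 ≤ 2 * M * n * (jumpCount S y - jumpCount S x) := by gcongr
    have h6 : n * |f y - f x| ≤ n * (2 * M) := by gcongr
    linarith

theorem stieltjes_slopeMajorant_apply {P : ℝ → ℝ} (hP : Monotone P) {M : ℝ} (hM : 0 ≤ M) (n : ℕ)
    (S : Finset ℝ) {B : Set ℝ} (hB : volume B = 0) (hBS : ∀ s ∈ S, s ∉ B) :
    (slopeMajorant_mono hP hM n S).stieltjesFunction.measure B = hP.stieltjesFunction.measure B := by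
  have h1 : Monotone fun x : ℝ => (n : ℝ) ^ 2 / 4 * x := monotone_id.const_mul (by positivity)
  have h2 : Monotone fun x : ℝ => 2 * M * n * jumpCount S x :=
    (jumpCount_mono S).const_mul (by positivity)
  rw [stieltjes_measure_add (h1.add hP) h2 (slopeMajorant_mono hP hM n S) (fun x => rfl),
    stieltjes_measure_add h1 hP (h1.add hP) (fun x => rfl)]
  have e1 : h1.stieltjesFunction.measure B = 0 :=
    stieltjes_measure_null_of_linear h1 ⟨(n : ℝ) ^ 2 / 4, by positivity⟩ (fun x => rfl) hB
  have e2 : h2.stieltjesFunction.measure B = 0 := by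
    refine stieltjes_measure_eq_zero_of_locally_const h2 fun x hx => ?_
    obtain ⟨c, hc⟩ := jumpCount_locally_const (S := S) (x := x) fun h => hBS x h hx
    exact ⟨2 * M * n * c, hc.mono fun y hy => by rw [hy]⟩
  rw [Measure.add_apply, Measure.add_apply, e1, e2, zero_add, add_zero]

theorem isFiniteMeasure_restrict_Ioo (m : Measure ℝ) [IsLocallyFiniteMeasure m] (a b : ℝ) :
    IsFiniteMeasure (m.restrict (Ioo a b)) :=
  ⟨by
    rw [Measure.restrict_apply_univ]
    exact (measure_mono Ioo_subset_Icc_self).trans_lt isCompact_Icc.measure_lt_top⟩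

/-- A bounded function with dominated slopes is a special function of bounded variation, and
the density of its derivative is its pointwise derivative. For each `n`, the derivative is dominated
by `n⁻¹` times the Stieltjes measure of `slopeMajorant P M n S`, which on null sets avoiding `S`
reduces to that of `P`; letting `n → ∞` excludes a Cantor part. -/
theorem SlopeDominated.exists_isDistribDeriv {a b : ℝ} (hab : a < b) {f P : ℝ → ℝ}
    (hP : Monotone P) (hf : SlopeDominated f P) {M : ℝ} (hM : ∀ x, |f x| ≤ M) :
    Measurable f ∧ ∃ μ : SignedMeasure ℝ, IsDistribDeriv (Ioo a b) f μ ∧ cantorPart μ = 0 ∧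
      ∀ᵐ x ∂volume.restrict (Ioo a b), HasDerivAt f (μ.rnDeriv volume x) x := by
  have hM0 : 0 ≤ M := (abs_nonneg _).trans (hM 0)
  choose S hS using hf
  have hKm := fun n => slopeMajorant_mono hP hM0 n (S n)
  set K := fun n => slopeMajorant P M n (S n)
  have hK : ∀ (n : ℕ) x y, x < y → n * |f y - f x| ≤ K n y - K n x := fun n x y hxy =>
    mul_abs_sub_le_slopeMajorant hP hM (hS n) hxy
  have hplus : ∀ n : ℕ, Monotone fun x => n * f x + K n x := by
    intro n x y hxy
    rcases hxy.eq_or_lt with rfl | hlt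
    · rfl
    have h1 := hK n x y hlt
    have h2 : n * -(f y - f x) ≤ n * |f y - f x| := by gcongr; exact neg_le_abs _
    dsimp only
    linarith
  have hminus : ∀ n : ℕ, Monotone fun x => K n x - n * f x := by
    intro n x y hxy
    rcases hxy.eq_or_lt with rfl | hlt
    · rfl
    have h1 := hK n x y hlt
    have h2 : n * (f y - f x) ≤ n * |f y - f x| := by gcongr; exact le_abs_self _
    dsimp only
    linarith
  -- `f` is the difference of the monotone functions `g` and `h`
  obtain ⟨g, h, hg, hh, hfgh⟩ : ∃ g h : ℝ → ℝ, Monotone g ∧ Monotone h ∧ ∀ x, f x = g x - h x :=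
    ⟨fun x => (1 : ℕ) * f x + K 1 x, K 1, hplus 1, hKm 1, fun x => by simp⟩
  have hfin : ∀ {k : ℝ → ℝ} (hk : Monotone k),
      IsFiniteMeasure (hk.stieltjesFunction.measure.restrict (Ioo a b)) := fun hk =>
    isFiniteMeasure_restrict_Ioo _ a b
  have := hfin hg
  have := hfin hh
  set mg := hg.stieltjesFunction.measure.restrict (Ioo a b) with hmg
  set mh := hh.stieltjesFunction.measure.restrict (Ioo a b) with hmh
  have hμB : ∀ B, MeasurableSet B →
      (mg.toSignedMeasure - mh.toSignedMeasure) B = mg.real B - mh.real B := fun B hB =>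
    Measure.toSignedMeasure_sub_apply hB
  -- the signed measure is dominated by the Stieltjes measures of the majorants
  have hdom : ∀ (n : ℕ) (B : Set ℝ), n * |mg.real B - mh.real B| ≤
      ((hKm n).stieltjesFunction.measure.restrict (Ioo a b)).real B := by
    intro n B
    have hng : Monotone fun x => (n : ℝ) * g x := hg.const_mul n.cast_nonneg
    have hnh : Monotone fun x => (n : ℝ) * h x := hh.const_mul n.cast_nonneg
    have s1 := stieltjes_measure_smul (n : NNReal) hg hng (fun x => by simp)
    have s2 := stieltjes_measure_smul (n : NNReal) hh hnh (fun x => by simp)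
    have hF : Monotone fun x => n * g x + K n x := hng.add (hKm n)
    have hF' : Monotone fun x => n * h x + K n x := hnh.add (hKm n)
    have t1 := stieltjes_measure_add hng (hKm n) hF (fun x => rfl)
    have t2 := stieltjes_measure_add hnh (hplus n) hF (fun x => by
      simp only [hfgh]; ring)
    have t3 := stieltjes_measure_add hnh (hKm n) hF' (fun x => rfl)
    have t4 := stieltjes_measure_add hng (hminus n) hF' (fun x => by
      simp only [hfgh]; ring)
    have r1 := congrArg (fun m : Measure ℝ => (m.restrict (Ioo a b)).real B) (t1.symm.trans t2)
    have r2 := congrArg (fun m : Measure ℝ => (m.restrict (Ioo a b)).real B) (t3.symm.trans t4)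
    have := hfin (hKm n)
    have := hfin (hplus n)
    have := hfin (hminus n)
    simp only [s1, s2, Measure.restrict_add, Measure.restrict_smul, ← hmg, ← hmh] at r1 r2
    rw [measureReal_add_apply, measureReal_add_apply, measureReal_nnreal_smul_apply,
      measureReal_nnreal_smul_apply] at r1 r2
    simp only [NNReal.coe_natCast] at r1 r2
    have p1 := measureReal_nonneg
      (μ := (hplus n).stieltjesFunction.measure.restrict (Ioo a b)) (s := B)
    have p2 := measureReal_nonneg
      (μ := (hminus n).stieltjesFunction.measure.restrict (Ioo a b)) (s := B)
    rw [← abs_of_nonneg (n.cast_nonneg : (0 : ℝ) ≤ n), ← abs_mul, abs_le]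
    constructor <;> linarith
  refine ⟨?_, mg.toSignedMeasure - mh.toSignedMeasure, ⟨?_, ?_⟩, ?_, ?_⟩
  · rw [show f = fun x => g x - h x from funext hfgh]
    exact hg.measurable.sub hh.measurable
  · rw [VectorMeasure.restrict_sub, VectorMeasure.restrict_toSignedMeasure measurableSet_Ioo,
      VectorMeasure.restrict_toSignedMeasure measurableSet_Ioo]
    congr 1 <;> refine Measure.toSignedMeasure_congr ?_ <;>
    · simp only [hmg, hmh]
      rw [Measure.restrict_restrict measurableSet_Ioo, inter_self]
  · intro φ hφ
    have hb : ∀ (m : Measure ℝ) [IsFiniteMeasure m], m.toSignedMeasure.Integrable φ := by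
      intro m hm
      obtain ⟨C, hC⟩ := hφ.2.1.exists_bound_of_continuous hφ.continuous
      rw [VectorMeasure.Integrable, Measure.variation_toSignedMeasure]
      exact Integrable.of_bound hφ.continuous.aestronglyMeasurable C (Eventually.of_forall hC)
    rw [VectorMeasure.integral_sub_vectorMeasure (hb _) (hb _),
      integral_lsmul_toSignedMeasure, integral_lsmul_toSignedMeasure]
    have e1 := integral_monotone_mul_deriv hab hg hφ
    have e2 := integral_monotone_mul_deriv hab hh hφ
    have hi : ∀ {k : ℝ → ℝ}, Monotone k → IntegrableOn k (Ioo a b) := fun hk =>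
      (hk.locallyIntegrable.integrableOn_isCompact isCompact_Icc).mono_set Ioo_subset_Icc_self
    simp only [hfgh, sub_mul]
    rw [integral_sub (hφ.integrable_mul_deriv (hi hg)) (hφ.integrable_mul_deriv (hi hh)), e1, e2]
    ring
  · refine cantorPart_eq_zero fun B hB hB0 hatom => ?_
    -- a finite set without atoms is not charged
    have hfinset : ∀ T : Finset ℝ, (∀ x ∈ T, x ∈ B) →
        (mg.toSignedMeasure - mh.toSignedMeasure) (T : Set ℝ) = 0 := by
      intro T
      induction T using Finset.induction_on with
      | empty => intro _; simp
      | insert x T hx ih =>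
        intro hT
        rw [Finset.coe_insert, Set.insert_eq, VectorMeasure.of_union
          (by simpa using hx) (measurableSet_singleton x) T.measurableSet,
          hatom x (hT x (Finset.mem_insert_self _ _)),
          ih fun y hy => hT y (Finset.mem_insert_of_mem hy), add_zero]
    set m := (mg.toSignedMeasure - mh.toSignedMeasure) B with hm
    set p := (hP.stieltjesFunction.measure.restrict (Ioo a b)).real univ with hp
    have hbound : ∀ n : ℕ, n * |m| ≤ p := by
      intro n
      classical
      have hsplit := VectorMeasure.of_add_of_sdiff (v := mg.toSignedMeasure - mh.toSignedMeasure)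
        (hB.inter (S n).measurableSet) hB inter_subset_left
      have hz : (mg.toSignedMeasure - mh.toSignedMeasure) (B ∩ (S n : Set ℝ)) = 0 := by
        have e : B ∩ (S n : Set ℝ) = ((S n).filter (· ∈ B) : Finset ℝ) := by
          ext x; simp [and_comm]
        rw [e]
        exact hfinset _ fun x hx => (Finset.mem_filter.1 hx).2
      rw [hz, zero_add, sdiff_self_inter, hμB _ (hB.diff (S n).measurableSet)] at hsplit
      rw [hm, ← hsplit]
      refine (hdom n _).trans ?_
      have hD : MeasurableSet (B \ (S n : Set ℝ)) := hB.diff (S n).measurableSet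
      have := hfin hP
      rw [measureReal_restrict_apply hD, measureReal_def, stieltjes_slopeMajorant_apply hP hM0 n (S n)
        (measure_mono_null (inter_subset_left.trans sdiff_subset) hB0)
        (fun s hs hs' => hs'.1.2 hs), ← measureReal_def, ← measureReal_restrict_apply hD]
      exact measureReal_mono (subset_univ _)
    by_contra hne
    obtain ⟨n, hn⟩ := exists_nat_gt (p / |m|)
    have hpos : 0 < |m| := abs_pos.2 hne
    rw [div_lt_iff₀ hpos] at hn
    exact absurd (hbound n) (not_le.2 hn)
  · have d1 := SignedMeasure.rnDeriv_sub mg.toSignedMeasure mh.toSignedMeasure volume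
    filter_upwards [ae_restrict_of_ae d1, ae_restrict_of_ae (rnDeriv_toSignedMeasure mg volume),
      ae_restrict_of_ae (rnDeriv_toSignedMeasure mh volume),
      ae_restrict_of_ae hg.ae_hasDerivAt, ae_restrict_of_ae hh.ae_hasDerivAt,
      ae_restrict_of_ae (Measure.rnDeriv_restrict hg.stieltjesFunction.measure volume
        (measurableSet_Ioo (a := a) (b := b))),
      ae_restrict_of_ae (Measure.rnDeriv_restrict hh.stieltjesFunction.measure volume
        (measurableSet_Ioo (a := a) (b := b))),
      ae_restrict_mem measurableSet_Ioo] with x x1 x2 x3 x4 x5 x6 x7 x8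
    rw [x1, Pi.sub_apply, x2, x3, hmg, hmh, x6, x7, indicator_of_mem x8, indicator_of_mem x8]
    exact (x4.sub x5).congr_of_eventuallyEq (Eventually.of_forall hfgh)

/-! ### Truncations and pointwise derivatives -/

theorem abs_truncate_le (M : ℕ) (u : ℝ → ℝ) (x : ℝ) : |truncate M u x| ≤ M := by
  have hM : (0 : ℝ) ≤ M := M.cast_nonneg
  rw [abs_le]
  exact ⟨le_max_right _ _, max_le (min_le_right _ _) (by linarith)⟩

theorem truncate_eq_self {M : ℕ} {u : ℝ → ℝ} {x : ℝ} (h : |u x| ≤ M) : truncate M u x = u x := by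
  rw [truncate, min_eq_left (abs_le.1 h).2, max_eq_left (abs_le.1 h).1]

theorem abs_truncate_sub_le (M : ℕ) (u : ℝ → ℝ) (x y : ℝ) :
    |truncate M u y - truncate M u x| ≤ |u y - u x| :=
  (abs_max_sub_max_le_abs _ _ _).trans (by
    simpa using abs_min_sub_min_le_max (u y) M (u x) M)

theorem SlopeDominated.truncate {u P : ℝ → ℝ} (hu : SlopeDominated u P) (M : ℕ) :
    SlopeDominated (truncate M u) P := by
  intro n
  obtain ⟨S, hS⟩ := hu n
  exact ⟨S, fun x y hxy h l hl =>
    (mul_le_mul_of_nonneg_left (abs_truncate_sub_le M u x y) hl.1).trans (hS x y hxy h l hl)⟩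

theorem SlopeDominated.memGSBV {a b : ℝ} (hab : a < b) {u P : ℝ → ℝ}
    (hP : Monotone P) (hu : SlopeDominated u P) : MemGSBV (Ioo a b) u := by
  intro M
  obtain ⟨hmeas, μ, h1, h2, -⟩ :=
    (hu.truncate M).exists_isDistribDeriv hab hP (abs_truncate_le M u)
  refine ⟨?_, μ, h1, h2⟩
  exact MemLp.of_bound hmeas.aestronglyMeasurable M
    (Eventually.of_forall fun x => abs_truncate_le M u x)

/-- A point outside a finite set has a neighbourhood in which no interval meets the set. -/
theorem exists_Ioo_forall_notMem_Icc (S : Finset ℝ) {x : ℝ} (hx : x ∉ S) :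
    ∃ p q, p < x ∧ x < q ∧ ∀ s ∈ S, s ∉ Ioo p q := by
  have : (S : Set ℝ)ᶜ ∈ 𝓝 x := S.finite_toSet.isClosed.isOpen_compl.mem_nhds hx
  obtain ⟨p, q, hpq, hsub⟩ := mem_nhds_iff_exists_Ioo_subset.1 this
  exact ⟨p, q, hpq.1, hpq.2, fun s hs hs' => hsub hs' hs⟩

/-- Off a finite set, a function with dominated slopes is locally bounded. -/
theorem SlopeDominated.exists_eventually_abs_le {u P : ℝ → ℝ} (hP : Monotone P)
    (hu : SlopeDominated u P) : ∃ S : Finset ℝ, ∀ x ∉ S, ∃ M : ℕ, ∀ᶠ y in 𝓝 x, |u y| ≤ M := by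
  obtain ⟨S, hS⟩ := hu 1
  refine ⟨S, fun x hx => ?_⟩
  obtain ⟨p, q, hp, hq, hpq⟩ := exists_Ioo_forall_notMem_Icc S hx
  obtain ⟨M, hM⟩ := exists_nat_ge (|u x| + ((q - p) + (P q - P p)))
  refine ⟨M, ?_⟩
  have key : ∀ y z, p < y → y < z → z < q → |u z - u y| ≤ (q - p) + (P q - P p) := by
    intro y z hy hyz hz
    have h := hS y z hyz (fun s hs hs' => hpq s hs ⟨hy.trans_le hs'.1, hs'.2.trans_lt hz⟩) 1
      ⟨zero_le_one, by norm_num⟩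
    have h1 := hP hy.le
    have h2 := hP hz.le
    linarith
  filter_upwards [Ioo_mem_nhds hp hq] with y hy
  refine le_trans ?_ hM
  have h0 : 0 ≤ (q - p) + (P q - P p) := by
    have := hP (hp.trans hq).le
    linarith
  rcases lt_trichotomy x y with h | rfl | h
  · have h1 := key x y hp h hy.2
    have h2 := abs_sub_abs_le_abs_sub (u y) (u x)
    linarith
  · linarith
  · have h1 := key y x hy.1 h hq
    have h2 := abs_sub_abs_le_abs_sub (u y) (u x)
    rw [abs_sub_comm] at h2
    linarith

/-- A function with dominated slopes is differentiable a.e., being locally equal to one of its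
truncations off a finite set. -/
theorem SlopeDominated.ae_hasDerivAt {a b : ℝ} (hab : a < b) {u P : ℝ → ℝ}
    (hP : Monotone P) (hu : SlopeDominated u P) :
    ∀ᵐ x ∂volume.restrict (Ioo a b), HasDerivAt u (deriv u x) x := by
  have h : ∀ M : ℕ, ∀ᵐ x ∂volume.restrict (Ioo a b),
      DifferentiableAt ℝ (PhaseField.truncate M u) x := by
    intro M
    obtain ⟨-, μ, -, -, h⟩ :=
      (hu.truncate M).exists_isDistribDeriv hab hP (abs_truncate_le M u)
    exact h.mono fun x hx => hx.differentiableAt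
  obtain ⟨S, hS⟩ := hu.exists_eventually_abs_le hP
  filter_upwards [ae_all_iff.2 h,
    ae_restrict_of_ae (S.finite_toSet.countable.ae_notMem volume)] with x hx hxS
  obtain ⟨M, hM⟩ := hS x hxS
  refine DifferentiableAt.hasDerivAt ((hx M).congr_of_eventuallyEq ?_)
  exact hM.mono fun y hy => (truncate_eq_self hy).symm

/-- Optimizing the domination over `l` gives the pointwise bound `(u')² ≤ P'`. -/
theorem SlopeDominated.sq_deriv_le {u P : ℝ → ℝ} (hu : SlopeDominated u P) :
    ∃ T : Set ℝ, T.Countable ∧ ∀ x ∉ T, ∀ w p, HasDerivAt u w x → HasDerivAt P p x →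
      w ^ 2 ≤ p := by
  choose S hS using hu
  refine ⟨⋃ n, (S n : Set ℝ), countable_iUnion fun n => (S n).countable_toSet, ?_⟩
  intro x hx w p hw hp
  obtain ⟨n, hn⟩ := exists_nat_ge (2 * |w|)
  obtain ⟨c, d, hc, hd, hcd⟩ := exists_Ioo_forall_notMem_Icc (S n) (x := x)
    fun h => hx (mem_iUnion.2 ⟨n, h⟩)
  have h1 : Tendsto (fun y => |(u y - u x) / (y - x)|) (𝓝[>] x) (𝓝 |w|) := by
    have := (hasDerivAt_iff_tendsto_slope.1 hw).mono_left (nhdsGT_le_nhdsNE x)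
    rw [slope_fun_def_field] at this
    exact this.abs
  have h2 : Tendsto (fun y => (P y - P x) / (y - x)) (𝓝[>] x) (𝓝 p) := by
    have := (hasDerivAt_iff_tendsto_slope.1 hp).mono_left (nhdsGT_le_nhdsNE x)
    rwa [slope_fun_def_field] at this
  have h3 : 2 * |w| * |w| ≤ (2 * |w|) ^ 2 / 4 + p := by
    refine le_of_tendsto_of_tendsto (h1.const_mul (2 * |w|)) (h2.const_add _) ?_
    filter_upwards [Ioo_mem_nhdsGT hd] with y hy
    have hpos : 0 < y - x := sub_pos.2 hy.1
    have h := hS n x y hy.1 (fun s hs hs' => hcd s hs ⟨hc.trans_le hs'.1, hs'.2.trans_lt hy.2⟩)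
      (2 * |w|) ⟨by positivity, hn⟩
    rw [abs_div, abs_of_pos hpos, ← mul_div_assoc, div_le_iff₀ hpos, add_mul,
      div_mul_cancel₀ _ hpos.ne']
    exact h
  have h4 : |w| ^ 2 = w ^ 2 := sq_abs w
  nlinarith

theorem SlopeDominated.memLp_deriv {a b : ℝ} (hab : a < b) {u P : ℝ → ℝ}
    (hP : Monotone P) (hu : SlopeDominated u P) :
    MemLp (deriv u) 2 (volume.restrict (Ioo a b)) := by
  obtain ⟨T, hT, hTw⟩ := hu.sq_deriv_le
  have := isFiniteMeasure_restrict_Ioo hP.stieltjesFunction.measure a b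
  rw [memLp_two_iff_integrable_sq (measurable_deriv u).aestronglyMeasurable]
  refine Integrable.mono' (g := fun x =>
    ((hP.stieltjesFunction.measure.restrict (Ioo a b)).rnDeriv volume x).toReal)
    Measure.integrable_toReal_rnDeriv.restrict
    ((measurable_deriv u).pow_const 2).aestronglyMeasurable ?_
  filter_upwards [hu.ae_hasDerivAt hab hP, ae_restrict_of_ae hP.ae_hasDerivAt,
    ae_restrict_of_ae (hT.ae_notMem volume),
    ae_restrict_of_ae (Measure.rnDeriv_restrict hP.stieltjesFunction.measure volume
        (measurableSet_Ioo (a := a) (b := b))),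
    ae_restrict_mem measurableSet_Ioo] with x h1 h2 h3 h4 h5
  rw [h4, indicator_of_mem h5, Real.norm_of_nonneg (sq_nonneg _)]
  exact hTw x h3 _ _ h1 h2

/-- Almost all points of a set of reals are accumulation points of it. -/
theorem ae_uniqueDiffWithinAt (A : Set ℝ) : ∀ᵐ x, x ∈ A → UniqueDiffWithinAt ℝ A x := by
  filter_upwards [(countable_setOfPred_isolated_right_within (s := A)).ae_notMem volume] with x hx hxA
  rw [uniqueDiffWithinAt_iff_accPt, accPt_principal_iff_nhdsWithin]
  have hne : (𝓝[A ∩ Ioi x] x).NeBot := ⟨fun h => hx ⟨hxA, h⟩⟩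
  exact hne.mono (nhdsWithin_mono x fun y hy => ⟨hy.1, (show x < y from hy.2).ne'⟩)

/-- On `{|u| ≤ M}` the function agrees with its truncation, so both derivatives agree at the
accumulation points of this set. -/
theorem SlopeDominated.isApproxDeriv {a b : ℝ} (hab : a < b) {u P : ℝ → ℝ}
    (hP : Monotone P) (hu : SlopeDominated u P) : IsApproxDeriv (Ioo a b) u (deriv u) := by
  intro M
  obtain ⟨-, μ, h1, -, h3⟩ :=
    (hu.truncate M).exists_isDistribDeriv hab hP (abs_truncate_le M u)
  refine ⟨μ, h1, ?_⟩
  filter_upwards [h3, hu.ae_hasDerivAt hab hP,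
    ae_restrict_of_ae (ae_uniqueDiffWithinAt {x | |u x| ≤ M})] with x hx hx' hd hxM
  refine (hd hxM).eq_deriv _ hx'.hasDerivWithinAt ?_
  exact hx.hasDerivWithinAt.congr (fun y hy => (truncate_eq_self hy).symm)
    (truncate_eq_self hxM).symm

/-! ### Selection of a convergent subsequence -/

/-- On `[x, y]` the phase field `V` is `1 / (n + 1)`-close to `1`, and the increments of `U` of
slope up to `n` are controlled by the increments of `P`. -/
def RegularOn (U V P : ℝ → ℝ) (n : ℕ) (x y : ℝ) : Prop :=
  (∀ z ∈ Icc x y, |V z - 1| ≤ 1 / ((n : ℝ) + 1)) ∧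
    ∀ s t, x ≤ s → s < t → t ≤ y → ∀ l ∈ Icc (0 : ℝ) n,
      l * |U t - U s| ≤ l ^ 2 / 4 * (t - s) + (P t - P s)

/-- A bounded monotone function oscillates by less than `κ` on all intervals avoiding
a suitable finite set: the levels `j κ / 2` are crossed at finitely many points only. -/
theorem exists_finset_sub_lt {P : ℝ → ℝ} (hP : Monotone P) {C : ℝ} (hPC : ∀ x, P x ∈ Icc 0 C)
    {κ : ℝ} (hκ : 0 < κ) :
    ∃ S : Finset ℝ, ∀ x y, x < y → (∀ s ∈ S, s ∉ Icc x y) → P y - P x < κ := by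
  obtain ⟨N, hN⟩ := exists_nat_gt (C / (κ / 2))
  rw [div_lt_iff₀ (half_pos hκ)] at hN
  refine ⟨(Finset.range N).image fun j : ℕ => sSup {x | P x ≤ j * (κ / 2)}, fun x y hxy h => ?_⟩
  by_contra! hcon
  have hex : ∃ j : ℕ, P x ≤ j * (κ / 2) := ⟨N, (hPC x).2.trans hN.le⟩
  classical
  obtain ⟨j, hj, hmin⟩ : ∃ j : ℕ, P x ≤ j * (κ / 2) ∧ j * (κ / 2) < P y := by
    refine ⟨Nat.find hex, Nat.find_spec hex, ?_⟩
    rcases Nat.eq_zero_or_eq_succ_pred (Nat.find hex) with h0 | h0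
    · rw [h0]
      have := (hPC x).1
      push_cast
      linarith
    · have hlt := Nat.find_min hex (m := (Nat.find hex).pred) (by omega)
      rw [h0]
      push_cast [Nat.succ_eq_add_one]
      rw [not_le] at hlt
      linarith
  have hjN : j < N := by
    have h1 : (j : ℝ) * (κ / 2) < N * (κ / 2) := hmin.trans_le ((hPC y).2.trans hN.le)
    exact_mod_cast lt_of_mul_lt_mul_right h1 (half_pos hκ).le
  have hub : ∀ z ∈ {z | P z ≤ j * (κ / 2)}, z ≤ y := fun z hz =>
    le_of_lt (hP.reflect_lt ((show P z ≤ _ from hz).trans_lt hmin))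
  exact h _ (Finset.mem_image_of_mem _ (Finset.mem_range.2 hjN))
    ⟨le_csSup ⟨y, hub⟩ hj, csSup_le ⟨x, hj⟩ hub⟩

/-- If intervals of little energy are eventually regular, then a subsequence of `U` converges a.e.
to a function with dominated slopes. The limit is constructed at *every* point, as the limit along
a fixed nonprincipal ultrafilter, which makes the domination inequality pass to the limit at once;
a subsequence converging at the rational points then converges almost everywhere. -/
theorem exists_subseq_slopeDominated {a b : ℝ} {U V P : ℕ → ℝ → ℝ} {C C₁ : ℝ}
    (hP : ∀ k, Monotone (P k)) (hPC : ∀ k x, P k x ∈ Icc 0 C)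
    (hU : ∀ k p q, a < p → p < q → q < b → ∃ z ∈ Icc p q, |U k z| * (q - p) ≤ C₁)
    (hreg : ∀ n : ℕ, ∃ κ > 0, ∀ x y, a < x → x < y → y < b →
      ∀ᶠ k in atTop, P k y - P k x < κ → RegularOn (U k) (V k) (P k) n x y) :
    ∃ (ψ : ℕ → ℕ) (u P₀ : ℝ → ℝ), StrictMono ψ ∧ Monotone P₀ ∧ SlopeDominated u P₀ ∧
      ∀ᵐ x ∂volume.restrict (Ioo a b),
        Tendsto (fun k => U (ψ k) x) atTop (𝓝 (u x)) ∧
        Tendsto (fun k => V (ψ k) x) atTop (𝓝 1) := by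
  classical
  have hF : ((hyperfilter ℕ : Ultrafilter ℕ) : Filter ℕ) ≤ atTop := Nat.hyperfilter_le_atTop
  set F : Ultrafilter ℕ := hyperfilter ℕ
  have hlim : ∀ x, ∃ p ∈ Icc 0 C, Tendsto (fun k => P k x) F (𝓝 p) := fun x => by
    obtain ⟨p, hp, h⟩ := isCompact_Icc.ultrafilter_le_nhds (F.map fun k => P k x)
      (le_principal_iff.2 (mem_map.2 (Eventually.of_forall fun k => hPC k x)))
    exact ⟨p, hp, h⟩
  choose P₀ hP₀C hP₀ using hlim
  have hP₀m : Monotone P₀ := fun x y hxy =>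
    le_of_tendsto_of_tendsto' (hP₀ x) (hP₀ y) fun k => hP k hxy
  choose κ hκ hreg using hreg
  choose S₀ hS₀ using fun n => exists_finset_sub_lt hP₀m hP₀C (hκ n)
  -- intervals avoiding `S₀ n` are regular for ultrafilter-many indices
  have hregF : ∀ n x y, a < x → x < y → y < b → (∀ s ∈ S₀ n, s ∉ Icc x y) →
      ∀ᶠ k in (F : Filter ℕ), RegularOn (U k) (V k) (P k) n x y := by
    intro n x y hx hxy hy hS
    filter_upwards [hF (hreg n x y hx hxy hy),
      ((hP₀ y).sub (hP₀ x)).eventually_lt_const (hS₀ n x y hxy hS)] with k h1 h2 using h1 h2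
  have hlimU : ∀ x ∈ Ioo a b, x ∉ S₀ 1 → ∃ l, Tendsto (fun k => U k x) F (𝓝 l) := by
    intro x hx hxS
    obtain ⟨p', q', hp', hq', hS⟩ := exists_Ioo_forall_notMem_Icc (S₀ 1) hxS
    obtain ⟨p, hp1, hp2⟩ := exists_between (max_lt hp' hx.1)
    obtain ⟨q, hq1, hq2⟩ := exists_between (lt_min hq' hx.2)
    rw [max_lt_iff] at hp1
    rw [lt_min_iff] at hq2
    have hpq := hp2.trans hq1
    have hb : ∀ᶠ k in (F : Filter ℕ), U k x ∈
        Icc (-(C₁ / (q - p) + ((q - p) + C))) (C₁ / (q - p) + ((q - p) + C)) := by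
      filter_upwards [hregF 1 p q hp1.2 hpq hq2.2 fun s hs hs' =>
        hS s hs ⟨hp1.1.trans_le hs'.1, hs'.2.trans_lt hq2.1⟩] with k hk
      obtain ⟨z, hz, hzU⟩ := hU k p q hp1.2 hpq hq2.2
      rw [← le_div_iff₀ (sub_pos.2 hpq)] at hzU
      have hdiff : ∀ s t, p ≤ s → s < t → t ≤ q → |U k t - U k s| ≤ (q - p) + C := by
        intro s t hs hst ht
        have h1 := hk.2 s t hs hst ht 1 ⟨zero_le_one, by norm_num⟩
        have h2 := (hPC k t).2
        have h3 := (hPC k s).1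
        linarith
      have hC : 0 ≤ C := (hPC k x).1.trans (hPC k x).2
      rw [mem_Icc, ← abs_le]
      rcases lt_trichotomy z x with h | rfl | h
      · have h1 := hdiff z x hz.1 h hq1.le
        have h2 := abs_sub_abs_le_abs_sub (U k x) (U k z)
        linarith
      · linarith
      · have h1 := hdiff x z hp2.le h hz.2
        have h2 := abs_sub_abs_le_abs_sub (U k x) (U k z)
        rw [abs_sub_comm] at h2
        linarith
    obtain ⟨l, -, hl⟩ := isCompact_Icc.ultrafilter_le_nhds (F.map fun k => U k x)
      (le_principal_iff.2 hb)
    exact ⟨l, hl⟩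
  obtain ⟨u, hu, hu0⟩ : ∃ u : ℝ → ℝ, (∀ x ∈ Ioo a b, x ∉ S₀ 1 →
      Tendsto (fun k => U k x) F (𝓝 (u x))) ∧ ∀ x ∉ Ioo a b, u x = 0 := by
    refine ⟨fun x => if h : x ∈ Ioo a b ∧ x ∉ S₀ 1 then (hlimU x h.1 h.2).choose else 0, ?_, ?_⟩
    · intro x hx hxS
      simp only [dif_pos (And.intro hx hxS)]
      exact (hlimU x hx hxS).choose_spec
    · intro x hx
      exact dif_neg fun h => hx h.1
  have hdom : ∀ n x y, a < x → x < y → y < b → (∀ s ∈ S₀ n, s ∉ Icc x y) →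
      x ∉ S₀ 1 → y ∉ S₀ 1 → ∀ l ∈ Icc (0 : ℝ) n,
      l * |u y - u x| ≤ l ^ 2 / 4 * (y - x) + (P₀ y - P₀ x) := by
    intro n x y hx hxy hy hS hx1 hy1 l hl
    refine le_of_tendsto_of_tendsto
      ((((hu y ⟨hx.trans hxy, hy⟩ hy1).sub (hu x ⟨hx, hxy.trans hy⟩ hx1)).abs).const_mul l)
      (((hP₀ y).sub (hP₀ x)).const_add (l ^ 2 / 4 * (y - x))) ?_
    filter_upwards [hregF n x y hx hxy hy hS] with k hk
    exact hk.2 x y le_rfl hxy le_rfl l hl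
  have hslope : SlopeDominated u P₀ := by
    intro n
    refine ⟨insert a (insert b (S₀ n ∪ S₀ 1)), fun x y hxy hS l hl => ?_⟩
    simp only [Finset.mem_insert, Finset.mem_union, forall_eq_or_imp] at hS
    obtain ⟨haS, hbS, hS⟩ := hS
    by_cases hx : x ∈ Ioo a b
    · have hy : y < b := not_le.1 fun h => hbS ⟨hx.2.le, h⟩
      exact hdom n x y hx.1 hxy hy (fun s hs => hS s (Or.inl hs))
        (fun h => hS x (Or.inr h) ⟨le_rfl, hxy.le⟩) (fun h => hS y (Or.inr h) ⟨hxy.le, le_rfl⟩) l hl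
    · have hy : y ∉ Ioo a b := fun hy => by
        rcases le_or_gt x a with h | h
        · exact haS ⟨h, hy.1.le⟩
        · exact hx ⟨h, hxy.trans hy.2⟩
      rw [hu0 x hx, hu0 y hy, sub_zero, abs_zero, mul_zero]
      have := hP₀m hxy.le
      have h2 : 0 ≤ l ^ 2 / 4 * (y - x) := mul_nonneg (by positivity) (sub_nonneg.2 hxy.le)
      linarith
  -- a subsequence converging at the rational points
  obtain ⟨ψ, hψ, hψlim⟩ : ∃ ψ : ℕ → ℕ, StrictMono ψ ∧ ∀ q : ℚ,
      ((q : ℝ) ∈ Ioo a b → (q : ℝ) ∉ S₀ 1 →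
        Tendsto (fun k => U (ψ k) q) atTop (𝓝 (u q))) ∧
      Tendsto (fun k => P (ψ k) q) atTop (𝓝 (P₀ q)) := by
    let X : ℕ → ℚ → ℝ × ℝ := fun k q =>
      (if (q : ℝ) ∈ Ioo a b ∧ (q : ℝ) ∉ S₀ 1 then U k q else 0, P k q)
    let X₀ : ℚ → ℝ × ℝ := fun q =>
      (if (q : ℝ) ∈ Ioo a b ∧ (q : ℝ) ∉ S₀ 1 then u q else 0, P₀ q)
    have hX : Tendsto X F (𝓝 X₀) := by
      rw [tendsto_pi_nhds]
      intro q
      refine Tendsto.prodMk_nhds ?_ (hP₀ q)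
      split_ifs with h
      · exact hu q h.1 h.2
      · exact tendsto_const_nhds
    obtain ⟨ψ, hψ, h⟩ := (hX.mapClusterPt.mono hF).tendsto_subseq
    rw [tendsto_pi_nhds] at h
    refine ⟨ψ, hψ, fun q => ⟨fun h1 h2 => ?_, (Prod.tendsto_iff _ _).1 (h q) |>.2⟩⟩
    have := (Prod.tendsto_iff _ _).1 (h q) |>.1
    simpa only [X, X₀, Function.comp_apply, h1, h2, not_false_eq_true, and_self, if_true] using this
  have hregψ : ∀ n (p q : ℚ), a < p → (p : ℝ) < q → (q : ℝ) < b →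
      (∀ s ∈ S₀ n, s ∉ Icc (p : ℝ) q) →
      ∀ᶠ k in atTop, RegularOn (U (ψ k)) (V (ψ k)) (P (ψ k)) n p q := by
    intro n p q hp hpq hq hS
    filter_upwards [hψ.tendsto_atTop.eventually (hreg n p q hp hpq hq),
      ((hψlim q).2.sub (hψlim p).2).eventually_lt_const (hS₀ n p q hpq hS)] with k h1 h2 using h1 h2
  refine ⟨ψ, u, P₀, hψ, hP₀m, hslope, ?_⟩
  have hS₀c : (⋃ n, (S₀ n : Set ℝ)).Countable := countable_iUnion fun n => (S₀ n).countable_toSet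
  filter_upwards [ae_restrict_mem measurableSet_Ioo, ae_restrict_of_ae (hS₀c.ae_notMem volume),
    ae_restrict_of_ae (hP₀m.countable_not_continuousAt.ae_notMem volume)] with x hx hxS hxc
  rw [not_not] at hxc
  have hxS' : ∀ n, x ∉ S₀ n := fun n h => hxS (mem_iUnion.2 ⟨n, h⟩)
  -- small rational neighbourhoods of `x`
  have hnhd : ∀ n, ∀ η > 0, ∃ p q : ℚ, a < p ∧ (p : ℝ) < x ∧ x < q ∧ (q : ℝ) < b ∧
      (∀ s ∈ S₀ n, s ∉ Icc (p : ℝ) q) ∧ (q : ℝ) - p < η ∧ P₀ q - P₀ p < η := by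
    intro n η hη
    obtain ⟨p', q', hp', hq', hS⟩ := exists_Ioo_forall_notMem_Icc (S₀ n) (hxS' n)
    have hc : P₀ ⁻¹' Ioo (P₀ x - η / 2) (P₀ x + η / 2) ∈ 𝓝 x :=
      hxc.preimage_mem_nhds (Ioo_mem_nhds (by linarith) (by linarith))
    have hmem := inter_mem (inter_mem hc (Ioo_mem_nhds hp' hq'))
      (inter_mem (Ioo_mem_nhds hx.1 hx.2)
        (Ioo_mem_nhds (show x - η / 2 < x by linarith) (show x < x + η / 2 by linarith)))
    obtain ⟨c, d, hcd, hsub⟩ := mem_nhds_iff_exists_Ioo_subset.1 hmem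
    obtain ⟨p, hp1, hp2⟩ := exists_rat_btwn hcd.1
    obtain ⟨q, hq1, hq2⟩ := exists_rat_btwn hcd.2
    have hpm := hsub ⟨hp1, hp2.trans hcd.2⟩
    have hqm := hsub ⟨hcd.1.trans hq1, hq2⟩
    obtain ⟨⟨⟨p1, p2⟩, p3, p4⟩, ⟨p5, p6⟩, p7, p8⟩ := hpm
    obtain ⟨⟨⟨q1, q2⟩, q3, q4⟩, ⟨q5, q6⟩, q7, q8⟩ := hqm
    exact ⟨p, q, p5, hp2, hq1, q6, fun s hs hs' => hS s hs ⟨p3.trans_le hs'.1, hs'.2.trans_lt q4⟩,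
      by linarith, by linarith⟩
  constructor
  · rw [Metric.tendsto_atTop']
    intro ε hε
    obtain ⟨p, q, hap, hpx, hxq, hqb, hS, hpq, hPpq⟩ := hnhd 1 (ε / 8) (by linarith)
    have hpS : (p : ℝ) ∉ S₀ 1 := fun h => hS p h ⟨le_rfl, (hpx.trans hxq).le⟩
    have hl1 : (1 : ℝ) ∈ Icc (0 : ℝ) ((1 : ℕ) : ℝ) := ⟨zero_le_one, by norm_num⟩
    have hev : ∀ᶠ k in atTop, dist (U (ψ k) x) (u x) < ε := by
      filter_upwards [hregψ 1 p q hap (hpx.trans hxq) hqb hS,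
        ((hψlim q).2.sub (hψlim p).2).eventually_lt_const hPpq,
        Metric.tendsto_nhds.1 ((hψlim p).1 ⟨hap, hpx.trans (hxq.trans hqb)⟩ hpS) (ε / 8)
          (by linarith)] with k h1 h2 h3
      have e1 := h1.2 p x le_rfl hpx hxq.le 1 hl1
      have e2 := hdom 1 p x hap hpx hx.2 (fun s hs hs' => hS s hs ⟨hs'.1, hs'.2.trans hxq.le⟩) hpS
        (hxS' 1) 1 hl1
      have e3 := hP (ψ k) hxq.le
      have e4 := hP₀m hxq.le
      rw [Real.dist_eq] at h3 ⊢
      have e5 : |U (ψ k) x - u x| ≤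
          |U (ψ k) x - U (ψ k) p| + |U (ψ k) p - u p| + |u x - u p| := by
        rw [abs_sub_comm (u x)]
        exact (abs_sub_le _ (u p) _).trans (by gcongr; exact abs_sub_le _ _ _)
      linarith
    obtain ⟨N, hN⟩ := eventually_atTop.1 hev
    exact ⟨N, fun k hk => hN k (le_of_lt hk)⟩
  · refine Metric.tendsto_nhds.2 fun ε hε => ?_
    obtain ⟨n, hn⟩ := exists_nat_one_div_lt hε
    obtain ⟨p, q, hap, hpx, hxq, hqb, hS, -, -⟩ := hnhd n 1 one_pos
    filter_upwards [hregψ n p q hap (hpx.trans hxq) hqb hS] with k hk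
    exact (hk.1 x ⟨hpx.le, hxq.le⟩).trans_lt hn

/-! ### Lower bounds for the energy density -/

/-- `φ` is bounded from below by a multiple of `min t 1`. -/
theorem exists_mul_min_le {φ : ℝ → ℝ} {φinf dφ : ℝ}
    (hφ_nonneg : ∀ t, 0 ≤ t → 0 ≤ φ t) (hφ_mono : MonotoneOn φ (Ici 0))
    (hφ_top : Tendsto φ atTop (𝓝 φinf)) (hφ_zero : ∀ t, 0 ≤ t → (φ t = 0 ↔ t = 0))
    (hφ_deriv : HasDerivWithinAt φ dφ (Ici 0) 0) (hdφ : 0 < dφ) :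
    ∃ c, 0 < c ∧ c ≤ 1 ∧ (∀ t, 0 ≤ t → c * min t 1 ≤ φ t) ∧ c ≤ φinf := by
  have h0 : φ 0 = 0 := (hφ_zero 0 le_rfl).2 rfl
  have h1 : ∀ᶠ t in 𝓝[>] (0 : ℝ), dφ / 2 * t ≤ φ t := by
    have h := hφ_deriv.mono (Ioi_subset_Ici_self (a := (0 : ℝ)))
    rw [hasDerivWithinAt_iff_tendsto_slope' (self_notMem_Ioi)] at h
    filter_upwards [h.eventually_const_le (half_lt_self hdφ), self_mem_nhdsWithin] with t ht ht0
    rw [slope_def_field, h0, sub_zero, sub_zero, le_div_iff₀ ht0] at ht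
    exact ht
  obtain ⟨δ, hδ, hsub⟩ := mem_nhdsGT_iff_exists_Ioc_subset.1 h1
  have hδ0 : (0 : ℝ) < δ := hδ
  have hφδ : 0 < φ δ := lt_of_le_of_ne (hφ_nonneg δ hδ0.le) fun h =>
    hδ0.ne' ((hφ_zero δ hδ0.le).1 h.symm)
  have hmin : ∀ t, 0 ≤ t → min 1 (min (dφ / 2) (φ δ)) * min t 1 ≤ φ t := by
    intro t ht
    have hmt : 0 ≤ min t 1 := le_min ht zero_le_one
    rcases ht.eq_or_lt with rfl | ht0
    · simp [h0]
    rcases le_total t δ with htδ | htδ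
    · refine le_trans ?_ (hsub ⟨ht0, htδ⟩)
      exact mul_le_mul ((min_le_right _ _).trans (min_le_left _ _)) (min_le_left _ _) hmt
        (half_pos hdφ).le
    · refine le_trans ?_ (hφ_mono (mem_Ici.2 hδ0.le) (mem_Ici.2 ht) htδ)
      calc _ ≤ φ δ * 1 := mul_le_mul ((min_le_right _ _).trans (min_le_right _ _))
            (min_le_right _ _) hmt hφδ.le
        _ = φ δ := mul_one _
  refine ⟨min 1 (min (dφ / 2) (φ δ)), lt_min one_pos (lt_min (half_pos hdφ) hφδ), min_le_left _ _,
    hmin, ?_⟩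
  refine ge_of_tendsto hφ_top ?_
  filter_upwards [eventually_ge_atTop (1 : ℝ)] with t ht
  have := hmin t (zero_le_one.trans ht)
  rwa [min_eq_right ht, mul_one] at this

/-- The integrand of the energy, as a function of a representative `V` of the phase field and of
the weak derivatives `w`, `z` of both fields. -/
noncomputable def energyDensity (fhat Q pot φ : ℝ → ℝ) (φinf ε : ℝ) (V w z : ℝ → ℝ) (t : ℝ) : ℝ :=
  degradation fhat Q φ φinf ε (V t) * |w t| ^ 2 + pot (1 - V t) / (4 * ε) + ε * |z t| ^ 2

/-- Near `v = 1` the first two terms of the energy density dominate `l s - l² / 4` for all slopes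
`l ≤ n`: either `ε f² ≥ 1` and the elastic term is quadratic, or the product of both terms is
bounded below by `n² s²`, because `pot / Q` is large. -/
theorem exists_slope_le_density {fhat Q pot φ : ℝ → ℝ} {φinf c : ℝ}
    (hfhat_cont : ContinuousOn fhat (Icc 0 1)) (hQ_nonneg : ∀ t ∈ Icc (0 : ℝ) 1, 0 ≤ Q t)
    (hfhat_one : fhat 1 = 1) (hQ_zero : ∀ t ∈ Icc (0 : ℝ) 1, Q t = 0 ↔ t = 0)
    (hpot_nonneg : ∀ t ∈ Icc (0 : ℝ) 1, 0 ≤ pot t)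
    (hσ : Tendsto (fun t => Real.sqrt (pot t / Q t)) (𝓝[>] 0) atTop)
    (hc : 0 < c) (hc1 : c ≤ 1) (hφ : ∀ t, 0 ≤ t → c * min t 1 ≤ φ t) (hcφ : c ≤ φinf) (n : ℕ) :
    ∃ δ, 0 < δ ∧ δ < 1 ∧ ∀ t ∈ Icc (1 - δ) 1, ∀ ε > 0, ∀ s, 0 ≤ s → ∀ l ∈ Icc (0 : ℝ) n,
      c * (l * s - l ^ 2 / 4) ≤ degradation fhat Q φ φinf ε t * s ^ 2 + pot (1 - t) / (4 * ε) := by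
  have h1 : ∀ᶠ t in 𝓝[>] (0 : ℝ), 2 * (n : ℝ) ^ 2 * Q t ≤ pot t := by
    filter_upwards [hσ.eventually_ge_atTop (2 * (n : ℝ)), Ioo_mem_nhdsGT (zero_lt_one' ℝ)]
      with t ht ht1
    have htm : t ∈ Icc (0 : ℝ) 1 := Ioo_subset_Icc_self ht1
    have hQ : 0 < Q t := lt_of_le_of_ne (hQ_nonneg t htm) fun h =>
      ht1.1.ne' ((hQ_zero t htm).1 h.symm)
    have h2 := pow_le_pow_left₀ (by positivity) ht 2
    rw [Real.sq_sqrt (div_nonneg (hpot_nonneg t htm) hQ.le), le_div_iff₀ hQ] at h2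
    have h3 : 0 ≤ (n : ℝ) ^ 2 * Q t := by positivity
    linarith
  have h2 : ∀ᶠ t in 𝓝[>] (0 : ℝ), 1 / 2 ≤ fhat (1 - t) := by
    have hc : ContinuousWithinAt fhat (Icc 0 1) 1 := hfhat_cont 1 (by simp)
    have ht : Tendsto (fun t : ℝ => 1 - t) (𝓝[>] 0) (𝓝[Icc 0 1] 1) := by
      refine tendsto_nhdsWithin_iff.2 ⟨?_, ?_⟩
      · have : Tendsto (fun t : ℝ => 1 - t) (𝓝 0) (𝓝 (1 - 0)) := tendsto_const_nhds.sub tendsto_id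
        rw [sub_zero] at this
        exact this.mono_left nhdsWithin_le_nhds
      · filter_upwards [Ioo_mem_nhdsGT (zero_lt_one' ℝ)] with t ht
        exact ⟨by linarith [ht.2], by linarith [ht.1]⟩
    have h := hc.tendsto.comp ht
    rw [hfhat_one] at h
    exact h.eventually_const_le (by norm_num)
  obtain ⟨δ₀, hδ₀, hsub⟩ := mem_nhdsGT_iff_exists_Ioc_subset.1 (h1.and h2)
  have hδ₀' : (0 : ℝ) < δ₀ := hδ₀
  refine ⟨min δ₀ (1 / 2), lt_min hδ₀' (by norm_num), (min_le_right _ _).trans_lt (by norm_num), ?_⟩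
  intro t ht ε hε s hs l hl
  have hδ1 := min_le_left δ₀ (1 / 2)
  have hδ2 := min_le_right δ₀ (1 / 2)
  have ht0 : 0 ≤ t := by linarith [ht.1]
  have htm : 1 - t ∈ Icc (0 : ℝ) 1 := ⟨by linarith [ht.2], by linarith⟩
  have hpot := hpot_nonneg _ htm
  -- the quadratic regime
  have hquad : ∀ d, c ≤ d → c * (l * s - l ^ 2 / 4) ≤ d * s ^ 2 + pot (1 - t) / (4 * ε) := by
    intro d hd
    have e1 : c * (l * s - l ^ 2 / 4) ≤ c * s ^ 2 := by
      refine mul_le_mul_of_nonneg_left ?_ hc.le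
      nlinarith [sq_nonneg (s - l / 2)]
    have e2 : c * s ^ 2 ≤ d * s ^ 2 := mul_le_mul_of_nonneg_right hd (sq_nonneg s)
    have e3 : 0 ≤ pot (1 - t) / (4 * ε) := by positivity
    linarith
  unfold degradation
  split_ifs with ht1
  · have htm' : 1 - t ∈ Ioc 0 δ₀ := ⟨by linarith, by linarith [ht.1]⟩
    obtain ⟨hpotQ, hfh⟩ := hsub htm'
    rw [sub_sub_cancel] at hfh
    have hq : 0 < Q (1 - t) := lt_of_le_of_ne (hQ_nonneg _ htm) fun h =>
      htm'.1.ne' ((hQ_zero _ htm).1 h.symm)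
    rw [fFun, Real.sq_sqrt (div_nonneg (by linarith) hq.le)]
    set A := ε * (fhat t / Q (1 - t)) with hA
    have hApos : 0 < A := by
      have : 0 < fhat t := by linarith
      positivity
    have hφA := hφ A hApos.le
    rcases le_total 1 A with h | h
    · rw [min_eq_right h, mul_one] at hφA
      exact hquad _ hφA
    · rw [min_eq_left h] at hφA
      have e1 : c * A * s ^ 2 ≤ φ A * s ^ 2 := mul_le_mul_of_nonneg_right hφA (sq_nonneg s)
      have e2 : (n : ℝ) ^ 2 / (4 * A) ≤ pot (1 - t) / (4 * ε) := by
        rw [div_le_div_iff₀ (by positivity) (by positivity)]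
        have e3 : A * Q (1 - t) = ε * fhat t := by rw [hA]; field_simp
        have e4 : (2 * (n : ℝ) ^ 2 * Q (1 - t)) * A ≤ pot (1 - t) * A :=
          mul_le_mul_of_nonneg_right hpotQ hApos.le
        have e5 : (n : ℝ) ^ 2 * ε * (1 / 2) ≤ (n : ℝ) ^ 2 * ε * fhat t :=
          mul_le_mul_of_nonneg_left hfh (by positivity)
        have e6 : 2 * (n : ℝ) ^ 2 * Q (1 - t) * A = 2 * ((n : ℝ) ^ 2 * ε * fhat t) := by
          rw [mul_assoc (2 * (n : ℝ) ^ 2), mul_comm (Q _), e3]; ring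
        nlinarith
      -- Young's inequality, with weight `A`
      have e3 : (n : ℝ) * s ≤ A * s ^ 2 + (n : ℝ) ^ 2 / (4 * A) := by
        have : A * s ^ 2 + (n : ℝ) ^ 2 / (4 * A) - n * s = (2 * A * s - n) ^ 2 / (4 * A) := by
          field_simp; ring
        have h4 : 0 ≤ (2 * A * s - n) ^ 2 / (4 * A) := by positivity
        linarith
      have e4 : c * (l * s - l ^ 2 / 4) ≤ c * (n * s) := by
        refine mul_le_mul_of_nonneg_left ?_ hc.le
        have := mul_le_mul_of_nonneg_right hl.2 hs
        nlinarith [sq_nonneg l]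
      have e5 : c * (n * s) ≤ c * (A * s ^ 2 + (n : ℝ) ^ 2 / (4 * A)) :=
        mul_le_mul_of_nonneg_left e3 hc.le
      have e6 : c * ((n : ℝ) ^ 2 / (4 * A)) ≤ (n : ℝ) ^ 2 / (4 * A) :=
        mul_le_of_le_one_left (by positivity) hc1
      linarith
  · exact hquad _ hcφ

theorem degradation_nonneg {fhat Q φ : ℝ → ℝ} {φinf ε : ℝ} (hφ_nonneg : ∀ t, 0 ≤ t → 0 ≤ φ t)
    (hφinf : 0 ≤ φinf) (hε : 0 ≤ ε) (t : ℝ) : 0 ≤ degradation fhat Q φ φinf ε t := by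
  unfold degradation
  split_ifs
  · exact hφ_nonneg _ (by positivity)
  · exact hφinf

/-! ### Transitions of the phase field cost energy -/

/-- A continuous function taking a value below `α` and a value above `β` runs from one level to the
other on a subinterval where it stays below `β`. -/
theorem exists_crossing {V : ℝ → ℝ} {x y α β : ℝ} (hV : ContinuousOn V (Icc x y)) (hαβ : α ≤ β)
    {z z' : ℝ} (hz : z ∈ Icc x y) (hz' : z' ∈ Icc x y) (hzα : V z < α) (hzβ : β ≤ V z') :
    ∃ p ∈ Icc x y, ∃ q ∈ Icc x y, p ≤ q ∧ (∀ t ∈ Icc p q, V t ≤ β) ∧ β - α ≤ |V q - V p| := by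
  rcases le_total z z' with h | h
  · have hsub : Icc z z' ⊆ Icc x y := Icc_subset_Icc hz.1 hz'.2
    have hT : IsCompact (Icc z z' ∩ V ⁻¹' {β}) :=
      isCompact_Icc.of_isClosed_subset
        ((hV.mono hsub).preimage_isClosed_of_isClosed isClosed_Icc isClosed_singleton)
        inter_subset_left
    obtain ⟨r, hr, hrβ⟩ := intermediate_value_Icc h (hV.mono hsub) ⟨(hzα.trans_le hαβ).le, hzβ⟩
    obtain ⟨q, ⟨hq, hqβ⟩, hmin⟩ := hT.exists_isLeast ⟨r, hr, hrβ⟩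
    refine ⟨z, hz, q, hsub hq, hq.1, fun t ht => ?_, ?_⟩
    · by_contra! hcon
      have hsub' : Icc z t ⊆ Icc z z' := Icc_subset_Icc_right (ht.2.trans hq.2)
      obtain ⟨r', hr', hr'β⟩ := intermediate_value_Icc ht.1 (hV.mono (hsub'.trans hsub))
        ⟨(hzα.trans_le hαβ).le, hcon.le⟩
      have h1 := hmin ⟨hsub' hr', hr'β⟩
      have h2 : t = q := le_antisymm ht.2 (h1.trans hr'.2)
      rw [h2, show V q = β from hqβ] at hcon
      exact lt_irrefl _ hcon
    · rw [show V q = β from hqβ]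
      exact le_trans (by linarith) (le_abs_self _)
  · have hsub : Icc z' z ⊆ Icc x y := Icc_subset_Icc hz'.1 hz.2
    have hT : IsCompact (Icc z' z ∩ V ⁻¹' {β}) :=
      isCompact_Icc.of_isClosed_subset
        ((hV.mono hsub).preimage_isClosed_of_isClosed isClosed_Icc isClosed_singleton)
        inter_subset_left
    obtain ⟨r, hr, hrβ⟩ := intermediate_value_Icc' h (hV.mono hsub) ⟨(hzα.trans_le hαβ).le, hzβ⟩
    obtain ⟨q, ⟨hq, hqβ⟩, hmax⟩ := hT.exists_isGreatest ⟨r, hr, hrβ⟩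
    refine ⟨q, hsub hq, z, hz, hq.2, fun t ht => ?_, ?_⟩
    · by_contra! hcon
      have hsub' : Icc t z ⊆ Icc z' z := Icc_subset_Icc_left (hq.1.trans ht.1)
      obtain ⟨r', hr', hr'β⟩ := intermediate_value_Icc' ht.2 (hV.mono (hsub'.trans hsub))
        ⟨(hzα.trans_le hαβ).le, hcon.le⟩
      have h1 := hmax ⟨hsub' hr', hr'β⟩
      have h2 : t = q := le_antisymm (hr'.1.trans h1) ht.1
      rw [h2, show V q = β from hqβ] at hcon
      exact lt_irrefl _ hcon
    · rw [show V q = β from hqβ, abs_sub_comm]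
      exact le_trans (by linarith) (le_abs_self _)

/-- If the energy on `[x, y]` is below the cost `m (β - α)` of a transition between the levels
`α` and `β`, then the phase field stays above `α`, provided that staying below `β` throughout is
also too expensive. -/
theorem le_of_energy_lt {V z e : ℝ → ℝ} {x y α β m d : ℝ} (hαβ : α ≤ β) (hm : 0 ≤ m)
    (hV : ContinuousOn V (Icc x y))
    (hVinc : ∀ p ∈ Icc x y, ∀ q ∈ Icc x y, p ≤ q →
      ENNReal.ofReal |V q - V p| ≤ ∫⁻ t in Ioo p q, ENNReal.ofReal |z t|)
    (hlow : ∀ t ∈ Ioo x y, V t ≤ β → m * |z t| ≤ e t ∧ d ≤ e t)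
    (henergy : ∫⁻ t in Ioo x y, ENNReal.ofReal (e t) < ENNReal.ofReal (m * (β - α)))
    (hd : m * (β - α) ≤ d * (y - x)) : ∀ r ∈ Icc x y, α ≤ V r := by
  intro r hr
  by_contra! hcon
  obtain ⟨r', hr', hr'β⟩ : ∃ r' ∈ Icc x y, β ≤ V r' := by
    by_contra! hall
    refine absurd henergy (not_lt.2 ?_)
    calc ENNReal.ofReal (m * (β - α)) ≤ ENNReal.ofReal (d * (y - x)) := ENNReal.ofReal_le_ofReal hd
      _ ≤ ENNReal.ofReal d * ENNReal.ofReal (y - x) :=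
          (ENNReal.ofReal_mul' (sub_nonneg.2 (hr.1.trans hr.2))).le
      _ = ∫⁻ _ in Ioo x y, ENNReal.ofReal d := by rw [setLIntegral_const, Real.volume_Ioo]
      _ ≤ ∫⁻ t in Ioo x y, ENNReal.ofReal (e t) :=
          setLIntegral_mono' measurableSet_Ioo fun t ht =>
            ENNReal.ofReal_le_ofReal (hlow t ht (hall t (Ioo_subset_Icc_self ht)).le).2
  obtain ⟨p, hp, q, hq, hpq, hβ, hinc⟩ := exists_crossing hV hαβ hr hr' hcon hr'β
  refine absurd henergy (not_lt.2 ?_)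
  calc ENNReal.ofReal (m * (β - α)) ≤ ENNReal.ofReal m * ENNReal.ofReal |V q - V p| := by
        rw [← ENNReal.ofReal_mul hm]
        exact ENNReal.ofReal_le_ofReal (mul_le_mul_of_nonneg_left hinc hm)
    _ ≤ ENNReal.ofReal m * ∫⁻ t in Ioo p q, ENNReal.ofReal |z t| := by
        gcongr; exact hVinc p hp q hq hpq
    _ = ∫⁻ t in Ioo p q, ENNReal.ofReal (m * |z t|) := by
        rw [← lintegral_const_mul' _ _ ENNReal.ofReal_ne_top]
        simp only [ENNReal.ofReal_mul hm]
    _ ≤ ∫⁻ t in Ioo p q, ENNReal.ofReal (e t) :=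
        setLIntegral_mono' measurableSet_Ioo fun t ht => ENNReal.ofReal_le_ofReal
          (hlow t (Ioo_subset_Ioo hp.1 hq.2 ht) (hβ t (Ioo_subset_Icc_self ht))).1
    _ ≤ ∫⁻ t in Ioo x y, ENNReal.ofReal (e t) :=
        lintegral_mono_set (Ioo_subset_Ioo hp.1 hq.2)

/-! ### The distribution function of the energy -/

/-- The energy, up to the factor `c`, stored in `(a, b)` to the left of a point. -/
noncomputable def energyBelow (a b c : ℝ) (e : ℝ → ℝ) (x : ℝ) : ℝ :=
  (∫⁻ t in Ioo a b ∩ Iio x, ENNReal.ofReal (e t)).toReal / c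

theorem energyBelow_mono {a b c : ℝ} {e : ℝ → ℝ} (hc : 0 < c)
    (he : ∫⁻ t in Ioo a b, ENNReal.ofReal (e t) ≠ ⊤) : Monotone (energyBelow a b c e) := by
  intro x y hxy
  unfold energyBelow
  gcongr
  · exact ne_top_of_le_ne_top he (lintegral_mono_set inter_subset_left)

theorem energyBelow_mem_Icc {a b c B : ℝ} {e : ℝ → ℝ} (hc : 0 < c) (hB : 0 ≤ B)
    (he : ∫⁻ t in Ioo a b, ENNReal.ofReal (e t) ≤ ENNReal.ofReal B) (x : ℝ) :
    energyBelow a b c e x ∈ Icc 0 (B / c) := by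
  unfold energyBelow
  refine ⟨by positivity, ?_⟩
  gcongr
  refine ENNReal.toReal_le_of_le_ofReal hB ((lintegral_mono_set inter_subset_left).trans he)

theorem lintegral_le_energyBelow_sub {a b c x y : ℝ} {e : ℝ → ℝ} (hc : 0 < c)
    (he : ∫⁻ t in Ioo a b, ENNReal.ofReal (e t) ≠ ⊤) (hx : a < x) (hxy : x < y) (hy : y < b) :
    ∫⁻ t in Ioo x y, ENNReal.ofReal (e t) ≤
      ENNReal.ofReal (c * (energyBelow a b c e y - energyBelow a b c e x)) := by
  have hfin : ∀ s, ∫⁻ t in Ioo a b ∩ Iio s, ENNReal.ofReal (e t) ≠ ⊤ := fun s =>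
    ne_top_of_le_ne_top he (lintegral_mono_set inter_subset_left)
  unfold energyBelow
  rw [mul_sub, mul_div_cancel₀ _ hc.ne', mul_div_cancel₀ _ hc.ne',
    ENNReal.ofReal_sub _ ENNReal.toReal_nonneg, ENNReal.ofReal_toReal (hfin y),
    ENNReal.ofReal_toReal (hfin x)]
  refine ENNReal.le_sub_of_add_le_right (hfin x) ?_
  have hdisj : Disjoint (Ioo x y) (Ioo a b ∩ Iio x) :=
    Set.disjoint_left.2 fun t ht ht' => (ht.1.trans ht'.2).false
  rw [← lintegral_union (measurableSet_Ioo.inter measurableSet_Iio) hdisj]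
  refine lintegral_mono_set ?_
  rintro t (ht | ht)
  · exact ⟨⟨hx.trans ht.1, ht.2.trans hy⟩, ht.2⟩
  · exact ⟨ht.1, ht.2.trans hxy⟩

/-- Integrating the lower bound `c (l |w| - l² / 4) ≤ e` over `(x, y)`. -/
theorem mul_abs_sub_le_of_density {a b c l x y : ℝ} {U w e : ℝ → ℝ} (hc : 0 < c) (hl : 0 ≤ l)
    (he : ∫⁻ t in Ioo a b, ENNReal.ofReal (e t) ≠ ⊤) (hx : a < x) (hxy : x < y) (hy : y < b)
    (hU : ENNReal.ofReal |U y - U x| ≤ ∫⁻ t in Ioo x y, ENNReal.ofReal |w t|)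
    (hlow : ∀ t ∈ Ioo x y, c * (l * |w t| - l ^ 2 / 4) ≤ e t) :
    l * |U y - U x| ≤ l ^ 2 / 4 * (y - x) + (energyBelow a b c e y - energyBelow a b c e x) := by
  have hP := sub_nonneg.2 (energyBelow_mono hc he hxy.le)
  set D := energyBelow a b c e y - energyBelow a b c e x with hD
  have hyx := sub_pos.2 hxy
  have h1 : ENNReal.ofReal (c * (l * |U y - U x|)) ≤
      ENNReal.ofReal (c * (l ^ 2 / 4 * (y - x)) + c * D) := by
    calc ENNReal.ofReal (c * (l * |U y - U x|))
        = ENNReal.ofReal (c * l) * ENNReal.ofReal |U y - U x| := by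
          rw [← mul_assoc, ENNReal.ofReal_mul (by positivity)]
      _ ≤ ENNReal.ofReal (c * l) * ∫⁻ t in Ioo x y, ENNReal.ofReal |w t| := by gcongr
      _ = ∫⁻ t in Ioo x y, ENNReal.ofReal (c * l * |w t|) := by
          rw [← lintegral_const_mul' _ _ ENNReal.ofReal_ne_top]
          simp only [ENNReal.ofReal_mul (show 0 ≤ c * l by positivity)]
      _ ≤ ∫⁻ t in Ioo x y, (ENNReal.ofReal (c * (l ^ 2 / 4)) + ENNReal.ofReal (e t)) := by
          refine setLIntegral_mono' measurableSet_Ioo fun t ht => ?_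
          refine le_trans (ENNReal.ofReal_le_ofReal ?_) ENNReal.ofReal_add_le
          have := hlow t ht
          linarith
      _ = ENNReal.ofReal (c * (l ^ 2 / 4 * (y - x))) + ∫⁻ t in Ioo x y, ENNReal.ofReal (e t) := by
          rw [lintegral_add_left measurable_const, setLIntegral_const, Real.volume_Ioo,
            ← ENNReal.ofReal_mul (by positivity), mul_assoc]
      _ ≤ ENNReal.ofReal (c * (l ^ 2 / 4 * (y - x))) + ENNReal.ofReal (c * D) := by
          gcongr
          exact lintegral_le_energyBelow_sub hc he hx hxy hy
      _ = _ := (ENNReal.ofReal_add (by positivity) (by positivity)).symm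
  rw [ENNReal.ofReal_le_ofReal_iff (by positivity), ← mul_add] at h1
  exact le_of_mul_le_mul_left h1 hc

/-! ### Compactness -/

/-- Intervals of little energy are regular once `ε` is small: the phase field stays near `1`
there, since transitions are expensive, and near `1` the energy controls the slopes. -/
theorem exists_regularOn {a b c : ℝ} {fhat Q pot φ : ℝ → ℝ} {φinf : ℝ}
    (hfhat_cont : ContinuousOn fhat (Icc 0 1))
    (hQ_nonneg : ∀ t ∈ Icc (0 : ℝ) 1, 0 ≤ Q t) (hfhat_one : fhat 1 = 1)
    (hQ_zero : ∀ t ∈ Icc (0 : ℝ) 1, Q t = 0 ↔ t = 0)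
    (hpot_cont : ContinuousOn pot (Icc 0 1)) (hpot_nonneg : ∀ t ∈ Icc (0 : ℝ) 1, 0 ≤ pot t)
    (hpot_zero : ∀ t ∈ Icc (0 : ℝ) 1, pot t = 0 ↔ t = 0)
    (hσ : Tendsto (fun t => Real.sqrt (pot t / Q t)) (𝓝[>] 0) atTop)
    (hφ_nonneg : ∀ t, 0 ≤ t → 0 ≤ φ t) (hφinf : 0 < φinf)
    (hc : 0 < c) (hc1 : c ≤ 1) (hφ : ∀ t, 0 ≤ t → c * min t 1 ≤ φ t) (hcφ : c ≤ φinf) (n : ℕ) :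
    ∃ κ > 0, ∀ x y, a < x → x < y → y < b → ∃ ε₀ > 0, ∀ ε, 0 < ε → ε < ε₀ →
      ∀ U V w z : ℝ → ℝ, ContinuousOn V (Icc a b) → (∀ t, V t ∈ Icc (0 : ℝ) 1) →
      (∀ p ∈ Icc a b, ∀ q ∈ Icc a b, p ≤ q →
        ENNReal.ofReal |U q - U p| ≤ ∫⁻ t in Ioo p q, ENNReal.ofReal |w t|) →
      (∀ p ∈ Icc a b, ∀ q ∈ Icc a b, p ≤ q →
        ENNReal.ofReal |V q - V p| ≤ ∫⁻ t in Ioo p q, ENNReal.ofReal |z t|) →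
      ∫⁻ t in Ioo a b, ENNReal.ofReal (energyDensity fhat Q pot φ φinf ε V w z t) ≠ ⊤ →
      energyBelow a b c (energyDensity fhat Q pot φ φinf ε V w z) y
        - energyBelow a b c (energyDensity fhat Q pot φ φinf ε V w z) x < κ →
      RegularOn U V (energyBelow a b c (energyDensity fhat Q pot φ φinf ε V w z)) n x y := by
  obtain ⟨δ₀, hδ₀, hδ₀1, hslope⟩ := exists_slope_le_density hfhat_cont hQ_nonneg hfhat_one hQ_zero
    hpot_nonneg hσ hc hc1 hφ hcφ n
  set δ := min δ₀ (1 / ((n : ℝ) + 1)) with hδdef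
  have hδ : 0 < δ := lt_min hδ₀ (by positivity)
  have hδδ₀ : δ ≤ δ₀ := min_le_left _ _
  have hδn : δ ≤ 1 / ((n : ℝ) + 1) := min_le_right _ _
  -- a lower bound `m` for `√pot` away from `0`
  obtain ⟨m, hm, hmpot⟩ : ∃ m > 0, ∀ t ∈ Icc (δ / 2) 1, m ^ 2 ≤ pot t := by
    have hsub : Icc (δ / 2) 1 ⊆ Icc (0 : ℝ) 1 := Icc_subset_Icc_left (by linarith)
    obtain ⟨t₀, ht₀, hmin⟩ := isCompact_Icc.exists_isMinOn
      (nonempty_Icc.2 (show δ / 2 ≤ 1 by linarith)) (hpot_cont.mono hsub)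
    have hpos : 0 < pot t₀ := lt_of_le_of_ne (hpot_nonneg _ (hsub ht₀)) fun h => by
      have := (hpot_zero _ (hsub ht₀)).1 h.symm
      linarith [ht₀.1]
    refine ⟨Real.sqrt (pot t₀), Real.sqrt_pos.2 hpos, fun t ht => ?_⟩
    rw [Real.sq_sqrt hpos.le]
    exact hmin ht
  refine ⟨m * (δ / 2) / c, by positivity, fun x y hx hxy hy => ?_⟩
  have hyx : 0 < y - x := sub_pos.2 hxy
  refine ⟨m * (y - x) / (2 * δ), by positivity, ?_⟩
  intro ε hε hεε₀ U V w z hVc hV01 hU hV hfin hκ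
  have hV01' : ∀ t, 1 - V t ∈ Icc (0 : ℝ) 1 := fun t =>
    ⟨by linarith [(hV01 t).2], by linarith [(hV01 t).1]⟩
  have hIcc : Icc x y ⊆ Icc a b := Icc_subset_Icc hx.le hy.le
  have hpotε : ∀ t, 0 ≤ pot (1 - V t) / (4 * ε) := fun t =>
    div_nonneg (hpot_nonneg _ (hV01' t)) (by positivity)
  have hV_ge : ∀ r ∈ Icc x y, 1 - δ ≤ V r := by
    refine le_of_energy_lt (β := 1 - δ / 2) (m := m) (d := m ^ 2 / (4 * ε)) (z := z)
      (e := energyDensity fhat Q pot φ φinf ε V w z) (by linarith) hm.le (hVc.mono hIcc)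
      (fun p hp q hq hpq => hV p (hIcc hp) q (hIcc hq) hpq) ?_ ?_ ?_
    · intro t _ ht
      have h1 : m ^ 2 / (4 * ε) ≤ pot (1 - V t) / (4 * ε) := by
        gcongr
        exact hmpot _ ⟨by linarith, (hV01' t).2⟩
      have h2 : 0 ≤ degradation fhat Q φ φinf ε (V t) * |w t| ^ 2 :=
        mul_nonneg (degradation_nonneg hφ_nonneg hφinf.le hε.le _) (sq_nonneg _)
      have h3 : m * |z t| ≤ m ^ 2 / (4 * ε) + ε * |z t| ^ 2 := by
        have e : m ^ 2 / (4 * ε) + ε * |z t| ^ 2 - m * |z t| = (m - 2 * ε * |z t|) ^ 2 / (4 * ε) := by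
          field_simp; ring
        have : 0 ≤ (m - 2 * ε * |z t|) ^ 2 / (4 * ε) := by positivity
        linarith
      have h4 : 0 ≤ ε * |z t| ^ 2 := by positivity
      unfold energyDensity
      constructor <;> linarith
    · refine (lintegral_le_energyBelow_sub hc hfin hx hxy hy).trans_lt ?_
      rw [ENNReal.ofReal_lt_ofReal_iff (mul_pos hm (by linarith))]
      rw [lt_div_iff₀ hc] at hκ
      linarith
    · rw [lt_div_iff₀ (by positivity)] at hεε₀
      rw [div_mul_eq_mul_div, le_div_iff₀ (by positivity)]
      nlinarith
  refine ⟨fun r hr => ?_, fun s t hs hst ht l hl => ?_⟩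
  · rw [abs_sub_comm, abs_of_nonneg (hV01' r).1]
    linarith [hV_ge r hr]
  · refine mul_abs_sub_le_of_density hc hl.1 hfin (hx.trans_le hs) hst (ht.trans_lt hy)
      (hU s (hIcc ⟨hs, hst.le.trans ht⟩) t (hIcc ⟨hs.trans hst.le, ht⟩) hst.le) fun r hr => ?_
    have h1 := hslope (V r) ⟨by linarith [hV_ge r ⟨hs.trans hr.1.le, hr.2.le.trans ht⟩], (hV01 r).2⟩
      ε hε |w r| (abs_nonneg _) l hl
    have h2 : 0 ≤ ε * |z r| ^ 2 := by positivity
    unfold energyDensity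
    linarith

/-- Functions of finite energy have representatives whose increments are controlled by their weak
derivatives, and the energy can be computed with them. -/
theorem exists_representatives {a b : ℝ} (hab : a < b) {fhat Q pot φ : ℝ → ℝ} {φinf ε B : ℝ}
    {u v : ℝ → ℝ} (hE : energy (Ioo a b) fhat Q pot φ φinf ε u v ≤ ENNReal.ofReal B) :
    ∃ U V w z : ℝ → ℝ, ContinuousOn V (Icc a b) ∧ (∀ t, V t ∈ Icc (0 : ℝ) 1) ∧
      (∀ p ∈ Icc a b, ∀ q ∈ Icc a b, p ≤ q →
        ENNReal.ofReal |U q - U p| ≤ ∫⁻ t in Ioo p q, ENNReal.ofReal |w t|) ∧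
      (∀ p ∈ Icc a b, ∀ q ∈ Icc a b, p ≤ q →
        ENNReal.ofReal |V q - V p| ≤ ∫⁻ t in Ioo p q, ENNReal.ofReal |z t|) ∧
      ∫⁻ t in Ioo a b, ENNReal.ofReal (energyDensity fhat Q pot φ φinf ε V w z t)
        ≤ ENNReal.ofReal B ∧
      (∀ᵐ t ∂volume.restrict (Ioo a b), u t = U t) ∧
      (∀ᵐ t ∂volume.restrict (Ioo a b), v t = V t) := by
  classical
  have hmem : MemH1 (Ioo a b) u ∧ MemH1 (Ioo a b) v ∧
      ∀ᵐ x ∂volume.restrict (Ioo a b), v x ∈ Icc (0 : ℝ) 1 := by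
    by_contra h
    rw [energy, if_neg h] at hE
    exact absurd hE (not_le.2 ENNReal.ofReal_lt_top)
  rw [energy, if_pos hmem] at hE
  obtain ⟨hu, hv, hv01⟩ := hmem
  obtain ⟨U, -, hUae, hUinc⟩ := hu.exists_representative hab
  obtain ⟨V, hVc, hVae, hVinc⟩ := hv.exists_representative hab
  -- truncating `V` makes its values lie in `[0, 1]` everywhere
  have hae : ∀ᵐ t ∂volume.restrict (Ioo a b), v t = max (min (V t) 1) 0 := by
    filter_upwards [hVae, hv01] with t h1 h2
    rw [← h1, min_eq_left h2.2, max_eq_left h2.1]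
  refine ⟨U, fun t => max (min (V t) 1) 0, weakDeriv (Ioo a b) u, weakDeriv (Ioo a b) v,
    ((continuous_id.min continuous_const).max continuous_const).comp_continuousOn hVc,
    fun t => ⟨le_max_right _ _, max_le (min_le_right _ _) zero_le_one⟩, hUinc, ?_, ?_, hUae, hae⟩
  · intro p hp q hq hpq
    refine (ENNReal.ofReal_le_ofReal ?_).trans (hVinc p hp q hq hpq)
    exact (abs_max_sub_max_le_abs _ _ _).trans
      (by simpa using abs_min_sub_min_le_max (V q) 1 (V p) 1)
  · refine (lintegral_congr_ae ?_).trans_le hE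
    filter_upwards [hae] with t ht
    simp only [energyDensity, ← ht]

end PhaseField

theorem theorem3p7
    (a b : ℝ) (hab : a < b)
    (fhat Q pot φ : ℝ → ℝ) (φinf dφ : ℝ)
    -- the functions `f̂` and `Q`
    (hfhat_cont : ContinuousOn fhat (Icc 0 1)) (hfhat_nonneg : ∀ t ∈ Icc (0 : ℝ) 1, 0 ≤ fhat t)
    (hQ_cont : ContinuousOn Q (Icc 0 1)) (hQ_nonneg : ∀ t ∈ Icc (0 : ℝ) 1, 0 ≤ Q t)
    (hfhat_one : fhat 1 = 1)
    (hfhat_zero : ∀ t ∈ Icc (0 : ℝ) 1, fhat t = 0 ↔ t = 0)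
    (hQ_zero : ∀ t ∈ Icc (0 : ℝ) 1, Q t = 0 ↔ t = 0)
    (hQ_mono : ∃ δ : ℝ, 0 < δ ∧ δ < 1 ∧ MonotoneOn Q (Ico 0 δ))
    (hf_mono : ∃ δ : ℝ, 0 < δ ∧ δ < 1 ∧ MonotoneOn (PhaseField.fFun fhat Q) (Ico 0 δ))
    -- the damage potential `pot`, with `σ̄ = lim_{t → 0⁺} (pot(t)/Q(t))^{1/2} = ∞`
    (hpot_cont : ContinuousOn pot (Icc 0 1)) (hpot_nonneg : ∀ t ∈ Icc (0 : ℝ) 1, 0 ≤ pot t)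
    (hpot_zero : ∀ t ∈ Icc (0 : ℝ) 1, pot t = 0 ↔ t = 0)
    (hσ : Tendsto (fun t => Real.sqrt (pot t / Q t)) (𝓝[>] 0) atTop)
    -- the function `φ`, with `φ(∞) = φinf ∈ (0,∞)` and `φ'(0⁺) = dφ ∈ (0,∞)`
    (hφ_cont : ContinuousOn φ (Ici 0)) (hφ_nonneg : ∀ t, 0 ≤ t → 0 ≤ φ t)
    (hφ_mono : MonotoneOn φ (Ici 0))
    (hφ_top : Tendsto φ atTop (𝓝 φinf)) (hφinf : 0 < φinf)
    (hφ_zero : ∀ t, 0 ≤ t → (φ t = 0 ↔ t = 0))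
    (hφ_deriv : HasDerivWithinAt φ dφ (Ici 0) 0) (hdφ : 0 < dφ)
    -- the family `(u_ε, v_ε)_{ε > 0}` in `L¹(Ω, ℝ²)`, where `Ω = (a, b)`
    (u v : ℝ → ℝ → ℝ)
    (hu : ∀ ε : ℝ, 0 < ε → MemLp (u ε) 1 (volume.restrict (Ioo a b)))
    (hv : ∀ ε : ℝ, 0 < ε → MemLp (v ε) 1 (volume.restrict (Ioo a b)))
    (hbound : (⨆ ε : Ioi (0 : ℝ),
      (PhaseField.energy (Ioo a b) fhat Q pot φ φinf ε (u ε) (v ε)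
        + eLpNorm (u ε) 1 (volume.restrict (Ioo a b)))) < ⊤) :
    ∃ (ε : ℕ → ℝ) (u₀ : ℝ → ℝ),
      (∀ k, 0 < ε k) ∧ Tendsto ε atTop (𝓝 0) ∧
      MemLp u₀ 1 (volume.restrict (Ioo a b)) ∧
      PhaseField.MemGSBV (Ioo a b) u₀ ∧
      (∃ w : ℝ → ℝ, PhaseField.IsApproxDeriv (Ioo a b) u₀ w ∧
        MemLp w 2 (volume.restrict (Ioo a b))) ∧
      (∀ᵐ x ∂volume.restrict (Ioo a b),
        Tendsto (fun k => u (ε k) x) atTop (𝓝 (u₀ x)) ∧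
        Tendsto (fun k => v (ε k) x) atTop (𝓝 1)) ∧
      (UnifIntegrable (fun (η : Ioi (0 : ℝ)) => u η) 1 (volume.restrict (Ioo a b)) →
        Tendsto (fun k => eLpNorm (u (ε k) - u₀) 1 (volume.restrict (Ioo a b))) atTop (𝓝 0)) := by
  obtain ⟨B, hB0, hB⟩ : ∃ B : ℝ, 0 ≤ B ∧ ∀ ε : ℝ, 0 < ε →
      PhaseField.energy (Ioo a b) fhat Q pot φ φinf ε (u ε) (v ε)
        + eLpNorm (u ε) 1 (volume.restrict (Ioo a b)) ≤ ENNReal.ofReal B := by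
    refine ⟨ENNReal.toReal (⨆ ε : Ioi (0 : ℝ),
      (PhaseField.energy (Ioo a b) fhat Q pot φ φinf ε (u ε) (v ε)
        + eLpNorm (u ε) 1 (volume.restrict (Ioo a b)))), ENNReal.toReal_nonneg, fun ε hε => ?_⟩
    rw [ENNReal.ofReal_toReal hbound.ne]
    exact le_iSup (fun ε : Ioi (0 : ℝ) =>
      PhaseField.energy (Ioo a b) fhat Q pot φ φinf ε (u ε) (v ε)
        + eLpNorm (u ε) 1 (volume.restrict (Ioo a b))) ⟨ε, hε⟩
  have hE := fun ε hε => le_self_add.trans (hB ε hε)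
  have hL1 := fun ε hε => le_add_self.trans (hB ε hε)
  obtain ⟨c, hc, hc1, hφc, hcφ⟩ :=
    PhaseField.exists_mul_min_le hφ_nonneg hφ_mono hφ_top hφ_zero hφ_deriv hdφ
  set η : ℕ → ℝ := fun k => 1 / ((k : ℝ) + 1) with hη
  have hηpos : ∀ k, 0 < η k := fun k => Nat.one_div_pos_of_nat
  have hηlim : Tendsto η atTop (𝓝 0) := tendsto_one_div_add_atTop_nhds_zero_nat
  choose U V w z hVc hV01 hUinc hVinc hEk hUae hVae using fun k =>
    PhaseField.exists_representatives hab (hE (η k) (hηpos k))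
  have hfin := fun k => ne_top_of_le_ne_top ENNReal.ofReal_ne_top (hEk k)
  obtain ⟨ψ, u₀, P₀, hψ, hP₀, hslope, hconv⟩ := PhaseField.exists_subseq_slopeDominated
    (a := a) (b := b) (U := U) (V := V) (C := B / c) (C₁ := B + 1)
    (P := fun k => PhaseField.energyBelow a b c
      (PhaseField.energyDensity fhat Q pot φ φinf (η k) (V k) (w k) (z k)))
    (fun k => PhaseField.energyBelow_mono hc (hfin k))
    (fun k => PhaseField.energyBelow_mem_Icc hc hB0 (hEk k))
    (by
      intro k p q hp hpq hq
      by_contra! hcon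
      have hqp := sub_pos.2 hpq
      have h1 : ENNReal.ofReal (B + 1) ≤ ENNReal.ofReal B := by
        calc ENNReal.ofReal (B + 1)
            = ∫⁻ _ in Ioo p q, ENNReal.ofReal ((B + 1) / (q - p)) := by
              rw [setLIntegral_const, Real.volume_Ioo, ← ENNReal.ofReal_mul (by positivity),
                div_mul_cancel₀ _ hqp.ne']
          _ ≤ ∫⁻ t in Ioo p q, ‖U k t‖ₑ := by
              refine setLIntegral_mono' measurableSet_Ioo fun t ht => ?_
              rw [Real.enorm_eq_ofReal_abs]
              refine ENNReal.ofReal_le_ofReal ?_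
              rw [div_le_iff₀ hqp]
              exact (hcon t (Ioo_subset_Icc_self ht)).le
          _ ≤ ∫⁻ t in Ioo a b, ‖U k t‖ₑ := lintegral_mono_set (Ioo_subset_Ioo hp.le hq.le)
          _ = eLpNorm (u (η k)) 1 (volume.restrict (Ioo a b)) := by
              rw [eLpNorm_one_eq_lintegral_enorm]
              exact lintegral_congr_ae ((hUae k).mono fun t ht => by simp only [ht])
          _ ≤ ENNReal.ofReal B := hL1 _ (hηpos k)
      rw [ENNReal.ofReal_le_ofReal_iff hB0] at h1
      linarith)
    (by
      intro n
      obtain ⟨κ, hκ, hreg⟩ := PhaseField.exists_regularOn (a := a) (b := b) hfhat_cont hQ_nonneg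
        hfhat_one hQ_zero hpot_cont hpot_nonneg hpot_zero hσ hφ_nonneg hφinf hc hc1 hφc hcφ n
      refine ⟨κ, hκ, fun x y hx hxy hy => ?_⟩
      obtain ⟨ε₀, hε₀, h⟩ := hreg x y hx hxy hy
      filter_upwards [hηlim.eventually_lt_const hε₀] with k hk
      exact h (η k) (hηpos k) hk (U k) (V k) (w k) (z k) (hVc k) (hV01 k) (hUinc k) (hVinc k)
        (hfin k))
  have hconv' : ∀ᵐ x ∂volume.restrict (Ioo a b),
      Tendsto (fun k => u (η (ψ k)) x) atTop (𝓝 (u₀ x)) ∧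
      Tendsto (fun k => v (η (ψ k)) x) atTop (𝓝 1) := by
    filter_upwards [hconv, ae_all_iff.2 hUae, ae_all_iff.2 hVae] with x hx h1 h2
    simpa only [h1, h2] using hx
  have hmeas : ∀ k, AEStronglyMeasurable (u (η (ψ k))) (volume.restrict (Ioo a b)) := fun k =>
    (hu _ (hηpos _)).1
  have hu₀ : MemLp u₀ 1 (volume.restrict (Ioo a b)) := by
    refine ⟨aestronglyMeasurable_of_tendsto_ae atTop hmeas (hconv'.mono fun x hx => hx.1), ?_⟩
    refine (Lp.eLpNorm_lim_le_liminf_eLpNorm hmeas u₀ (hconv'.mono fun x hx => hx.1)).trans_lt ?_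
    refine lt_of_le_of_lt ?_ (ENNReal.ofReal_lt_top (r := B))
    refine liminf_le_of_le (by isBoundedDefault) fun d hd => ?_
    obtain ⟨k, hk⟩ := hd.exists
    exact hk.trans (hL1 _ (hηpos _))
  refine ⟨fun k => η (ψ k), u₀, fun k => hηpos _, hηlim.comp hψ.tendsto_atTop, hu₀,
    hslope.memGSBV hab hP₀, ⟨deriv u₀, hslope.isApproxDeriv hab hP₀, hslope.memLp_deriv hab hP₀⟩,
    hconv', fun hui => ?_⟩
  refine tendsto_Lp_finite_of_tendsto_ae le_rfl ENNReal.one_ne_top hmeas hu₀ ?_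
    (hconv'.mono fun x hx => hx.1)
  intro r hr
  obtain ⟨δ, hδ, h⟩ := hui hr
  exact ⟨δ, hδ, fun k => h ⟨η (ψ k), hηpos _⟩⟩
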